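/- Let $\mathcal C$ be a locally small (strict) 2-category and let $\mathcal Cat$ be the 2-category of small categories. Write $\mathcal Hom(\mathcal C,\mathcal Cat)$ (resp. $\mathcal Hom_p(\mathcal C,\mathcal Cat)$) for the 2-category of 2-functors $\mathcal C\to\mathcal Cat$, 2-natural (resp. pseudonatural) transformations and modifications. The inclusion $i:\mathcal Hom(\mathcal C,\mathcal Cat)\to\mathcal Hom_p(\mathcal C,\mathcal Cat)$ has a left adjoint $(-)'$ (formed, when $\mathcal C$ is large, over categories whose hom sets are small but which may have as many objects as $\mathcal C$). That is, for each $\mathsf F$ there is a pseudonatural $\eta:\mathsf F\Rightarrow\mathsf F'$ such that precomposition with $\eta$ is an isomorphism of categories $\mathcal Hom(\mathcal C,\mathcal Cat)(\mathsf F',\mathsf G)\cong\mathcal Hom_p(\mathcal C,\mathcal Cat)(\mathsf F,\mathsf G)$ for all $\mathsf G$; the counit $\varepsilon_{\mathsf F}:\mathsf F'\Rightarrow\mathsf F$ is the unique 2-natural transformation with $\varepsilon_{\mathsf F}\eta=\mathrm{id}_{\mathsf F}$. The 2-functor $\mathsf F$ is called \emph{flexible} if $\varepsilon_{\mathsf F}$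 has a 2-natural section $\lambda:\mathsf F\Rightarrow\mathsf F'$, $\varepsilon_{\mathsf F}\lambda=\mathrm{id}_{\mathsf F}$, with $\lambda\varepsilon_{\mathsf F}\cong\mathrm{id}_{\mathsf F'}$ in $\mathcal Hom(\mathcal C,\mathcal Cat)$. The pseudocolimit in a 2-category $\mathcal A$ of a 2-functor $\mathsf D:\mathcal I\to\mathcal A$ is a pseudocone $\lambda$ from $\mathsf D$ to an object $\mathsf L$ (a pseudonatural transformation from $\mathsf D$ to the constant 2-functor at $\mathsf L$) such that for every object $\mathsf A$ composition with $\lambda$ is an isomorphism of categories from $\mathcal A(\mathsf L,\mathsf A)$ to the category of pseudocones for $\mathsf D$ with vertex $\mathsf A$. A 2-category $\mathcal I$ is \emph{2-filtered} if (F0) any two objects $i,j$ admit arrows $i\to k$, $j\to k$; (F1) for any arrows $f,g:i\to j$ there are an arrow $h:j\to k$ and an invertible 2-cell $hf\cong hg$; (F2) for any 2-cells $\alpha,\beta:f\Rightarrow g:i\to j$ there is an arrow $h:j\to k$ with $h\alpha=h\beta$. A \emph{2-pro-object} of $\mathcal C$ is a 2-functor $\mathsf X:\mathcal I^{op}\to\mathcal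 C$, with $\mathcal I$ a small 2-filtered 2-category, and its associated 2-functor $\mathsf{LX}:\mathcal C\to\mathcal Cat$ is the pseudocolimit in $\mathcal Hom(\mathcal C,\mathcal Cat)$ of the 2-functor $i\mapsto\mathcal C(\mathsf X_i,-)$, $i\in\mathcal I$. Then: 1. If $\mathcal I$ is a small 2-category, $\mathsf F_{(-)}:\mathcal I\to\mathcal Hom(\mathcal C,\mathcal Cat)$ is a 2-functor such that every $\mathsf F_j$ is flexible, and $\mathsf L$ is a pseudocolimit of it in $\mathcal Hom(\mathcal C,\mathcal Cat)$, then $\mathsf L$ is flexible. 2. If $\mathcal I$ is a small 2-category, $\mathsf F_{(-)}:\mathcal I\to\mathcal Hom(\mathcal C,\mathcal Cat)$ is a 2-functor such that every $\mathsf F_j$ is representable (isomorphic in $\mathcal Hom(\mathcal C,\mathcal Cat)$ to some $\mathcal C(\mathsf C,-)$), and $\mathsf L$ is a pseudocolimit of it in $\mathcal Hom(\mathcal C,\mathcal Cat)$, then $\mathsf L$ is flexible. 3. For every 2-pro-object $\mathsf X$ of $\mathcal C$, the associated 2-functor $\mathsf{LX}$ is flexible. -/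

import Mathlib

open CategoryTheory Bicategory Opposite

universe v u

namespace TwoCat

universe w₁ w₂ v₁ v₂ u₁ u₂

/-! ### 2-functors and 2-natural transformations

2-categories are strict bicategories, 2-functors are strict pseudofunctors, pseudonatural
transformations are strong transformations, and modifications are Mathlib's modifications. -/

section Hom

/-- 2-functors between 2-categories. -/
abbrev TwoFunctor (C : Type u₁) [Bicategory.{w₁, v₁} C] (D : Type u₂) [Bicategory.{w₂, v₂} D] :=
  StrictPseudofunctor C D

variable {C : Type u₁} [Bicategory.{w₁, v₁} C] {D : Type u₂} [Bicategory.{w₂, v₂} D]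

open scoped Pseudofunctor.StrongTrans

/-- The category `Hom_p(C, D)(F, G)` of pseudonatural transformations between two 2-functors;
its morphisms are the modifications. -/
abbrev PseudoNat (F G : TwoFunctor C D) := F.toPseudofunctor ⟶ G.toPseudofunctor

/-- A 2-natural transformation: a pseudonatural transformation all of whose structural
2-cells are identities. -/
structure TwoNat (F G : TwoFunctor C D) where
  /-- the underlying pseudonatural transformation (the inclusion `i`) -/
  toPseudoNat : PseudoNat F G
  comm : ∀ {a b : C} (f : a ⟶ b),
    F.map f ≫ toPseudoNat.app b = toPseudoNat.app a ≫ G.map f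
  naturality_eq : ∀ {a b : C} (f : a ⟶ b), toPseudoNat.naturality f = eqToIso (comm f)

namespace TwoNat

theorem ext_app {F G : TwoFunctor C D} {θ η : TwoNat F G}
    (h : ∀ a, θ.toPseudoNat.app a = η.toPseudoNat.app a) : θ = η := by
  obtain ⟨⟨θa, θn, h1, h2, h3⟩, θc, θe⟩ := θ
  obtain ⟨⟨ηa, ηn, k1, k2, k3⟩, ηc, ηe⟩ := η
  obtain rfl : θa = ηa := funext h
  have : @θn = @ηn := by
    funext a b f
    exact (θe f).trans (ηe f).symm
  subst this
  rfl

/-- The 2-cells between 2-natural transformations are the modifications. -/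
@[ext]
structure Hom {F G : TwoFunctor C D} (θ η : TwoNat F G) where
  of ::
  /-- the underlying modification -/
  mod : θ.toPseudoNat ⟶ η.toPseudoNat

instance category (F G : TwoFunctor C D) : Category (TwoNat F G) where
  Hom θ η := Hom θ η
  id θ := ⟨𝟙 θ.toPseudoNat⟩
  comp ρ τ := ⟨ρ.mod ≫ τ.mod⟩
  id_comp _ := Hom.ext (Category.id_comp _)
  comp_id _ := Hom.ext (Category.comp_id _)
  assoc _ _ _ := Hom.ext (Category.assoc _ _ _)

/-- An invertible modification between 2-natural transformations. -/
def isoMk {F G : TwoFunctor C D} {θ η : TwoNat F G} (e : θ.toPseudoNat ≅ η.toPseudoNat) :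
    θ ≅ η where
  hom := ⟨e.hom⟩
  inv := ⟨e.inv⟩
  hom_inv_id := Hom.ext e.hom_inv_id
  inv_hom_id := Hom.ext e.inv_hom_id

/-- The inclusion functor `Hom(C, D)(F, G) ⥤ Hom_p(C, D)(F, G)`. -/
def incl (F G : TwoFunctor C D) : TwoNat F G ⥤ PseudoNat F G where
  obj θ := θ.toPseudoNat
  map ρ := ρ.mod
  map_id _ := rfl
  map_comp _ _ := rfl

variable [Strict D]

/-- A 2-natural transformation is a natural transformation of the underlying functors that is
compatible with the 2-cells. -/
def mk' {F G : TwoFunctor C D} (app : ∀ a : C, F.obj a ⟶ G.obj a)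
    (comm : ∀ {a b : C} (f : a ⟶ b), F.map f ≫ app b = app a ≫ G.map f)
    (comm₂ : ∀ {a b : C} {f g : a ⟶ b} (α : f ⟶ g),
      F.map₂ α ▷ app b ≫ eqToHom (comm g) = eqToHom (comm f) ≫ app a ◁ G.map₂ α) :
    TwoNat F G where
  toPseudoNat :=
    { app := app
      naturality := fun f => eqToIso (comm f)
      naturality_naturality := comm₂
      naturality_id := fun a => by
        simp [F.mapId_eq_eqToIso, G.mapId_eq_eqToIso, Strict.leftUnitor_eqToIso,
          Strict.rightUnitor_eqToIso]
      naturality_comp := fun f g => by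
        simp [F.mapComp_eq_eqToIso, G.mapComp_eq_eqToIso, Strict.associator_eqToIso] }
  comm := comm
  naturality_eq _ := rfl

/-- The identity 2-natural transformation. -/
def id (F : TwoFunctor C D) : TwoNat F F where
  toPseudoNat := 𝟙 F.toPseudofunctor
  comm f := (Strict.comp_id _).trans (Strict.id_comp _).symm
  naturality_eq f := by
    apply Iso.ext
    simp [Strict.leftUnitor_eqToIso, Strict.rightUnitor_eqToIso]
    rfl

/-- Composition of 2-natural transformations. -/
def comp {F G H : TwoFunctor C D} (θ : TwoNat F G) (η : TwoNat G H) : TwoNat F H where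
  toPseudoNat := θ.toPseudoNat ≫ η.toPseudoNat
  comm f := by
    simp only [Pseudofunctor.StrongTrans.comp_app]
    rw [← Strict.assoc, θ.comm, Strict.assoc, η.comm, Strict.assoc]
  naturality_eq f := by
    apply Iso.ext
    simp [θ.naturality_eq, η.naturality_eq, Strict.associator_eqToIso]
    erw [eqToHom_trans, eqToHom_trans, eqToHom_trans, eqToHom_trans]
    rfl

end TwoNat

variable [Strict D]

/-- The 2-category `Hom(C, D)` of 2-functors, 2-natural transformations and modifications. -/
instance homBicategory : Bicategory (TwoFunctor C D) where
  Hom F G := TwoNat F G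
  id F := TwoNat.id F
  comp θ η := TwoNat.comp θ η
  homCategory F G := TwoNat.category F G
  whiskerLeft θ _ _ ρ := ⟨θ.toPseudoNat ◁ ρ.mod⟩
  whiskerRight ρ θ := ⟨ρ.mod ▷ θ.toPseudoNat⟩
  associator θ η ζ := TwoNat.isoMk (α_ θ.toPseudoNat η.toPseudoNat ζ.toPseudoNat)
  leftUnitor θ := TwoNat.isoMk (λ_ θ.toPseudoNat)
  rightUnitor θ := TwoNat.isoMk (ρ_ θ.toPseudoNat)
  whiskerLeft_id θ η := TwoNat.Hom.ext (whiskerLeft_id θ.toPseudoNat η.toPseudoNat)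
  whiskerLeft_comp θ _ _ _ ρ τ := TwoNat.Hom.ext (whiskerLeft_comp θ.toPseudoNat ρ.mod τ.mod)
  id_whiskerLeft ρ := TwoNat.Hom.ext (id_whiskerLeft ρ.mod)
  comp_whiskerLeft θ η _ _ ρ :=
    TwoNat.Hom.ext (comp_whiskerLeft θ.toPseudoNat η.toPseudoNat ρ.mod)
  id_whiskerRight θ η := TwoNat.Hom.ext (id_whiskerRight θ.toPseudoNat η.toPseudoNat)
  comp_whiskerRight ρ τ θ := TwoNat.Hom.ext (comp_whiskerRight ρ.mod τ.mod θ.toPseudoNat)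
  whiskerRight_id ρ := TwoNat.Hom.ext (whiskerRight_id ρ.mod)
  whiskerRight_comp ρ θ η :=
    TwoNat.Hom.ext (whiskerRight_comp ρ.mod θ.toPseudoNat η.toPseudoNat)
  whisker_assoc θ _ _ ρ η := TwoNat.Hom.ext
    (Bicategory.whisker_assoc θ.toPseudoNat ρ.mod η.toPseudoNat)
  whisker_exchange ρ τ := TwoNat.Hom.ext (whisker_exchange ρ.mod τ.mod)
  pentagon θ η ζ ξ := TwoNat.Hom.ext
    (pentagon θ.toPseudoNat η.toPseudoNat ζ.toPseudoNat ξ.toPseudoNat)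
  triangle θ η := TwoNat.Hom.ext (triangle θ.toPseudoNat η.toPseudoNat)

theorem eqToHom_mod_app {F G : TwoFunctor C D} {θ η : F ⟶ G} (h : θ = η) (a : C) :
    (eqToHom h).mod.as.app a = eqToHom (by rw [h]) := by
  subst h
  rfl

theorem hom_conj_app {F G : TwoFunctor C D} {θ η ζ ξ : F ⟶ G} (h : θ = η) (ρ : η ⟶ ζ)
    (h' : ζ = ξ) (a : C) :
    (eqToHom h ≫ ρ ≫ eqToHom h').mod.as.app a =
      eqToHom (by rw [h]) ≫ ρ.mod.as.app a ≫ eqToHom (by rw [h']) := by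
  subst h h'
  simp only [eqToHom_refl, Category.id_comp, Category.comp_id]

theorem hom_ext {F G : TwoFunctor C D} {θ η : F ⟶ G} {ρ τ : θ ⟶ η}
    (h : ∀ a, ρ.mod.as.app a = τ.mod.as.app a) : ρ = τ :=
  TwoNat.Hom.ext (Pseudofunctor.StrongTrans.homCategory.ext h)

theorem hom_id_comp {F G : TwoFunctor C D} (θ : F ⟶ G) : 𝟙 F ≫ θ = θ :=
  TwoNat.ext_app fun _ => Strict.id_comp _

theorem hom_comp_id {F G : TwoFunctor C D} (θ : F ⟶ G) : θ ≫ 𝟙 G = θ :=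
  TwoNat.ext_app fun _ => Strict.comp_id _

theorem hom_assoc {F G H K : TwoFunctor C D} (θ : F ⟶ G) (η : G ⟶ H) (ζ : H ⟶ K) :
    (θ ≫ η) ≫ ζ = θ ≫ η ≫ ζ :=
  TwoNat.ext_app fun _ => Strict.assoc _ _ _

/-- `Hom(C, D)` is a (strict) 2-category. -/
instance homStrict : Strict (TwoFunctor C D) where
  id_comp := hom_id_comp
  comp_id := hom_comp_id
  assoc := hom_assoc
  leftUnitor_eqToIso θ := Iso.ext (hom_ext fun a =>
    (congrArg Iso.hom (Strict.leftUnitor_eqToIso (θ.toPseudoNat.app a))).trans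
      (eqToHom_mod_app (hom_id_comp θ) a).symm)
  rightUnitor_eqToIso θ := Iso.ext (hom_ext fun a =>
    (congrArg Iso.hom (Strict.rightUnitor_eqToIso (θ.toPseudoNat.app a))).trans
      (eqToHom_mod_app (hom_comp_id θ) a).symm)
  associator_eqToIso θ η ζ := Iso.ext (hom_ext fun a =>
    (congrArg Iso.hom (Strict.associator_eqToIso (θ.toPseudoNat.app a)
      (η.toPseudoNat.app a) (ζ.toPseudoNat.app a))).trans
        (eqToHom_mod_app (hom_assoc θ η ζ) a).symm)

/-- Precomposition with a pseudonatural transformation `η : F ⇒ F'`, as a functor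
`Hom(C, D)(F', G) ⥤ Hom_p(C, D)(F, G)`. -/
def precompPseudo {F F' : TwoFunctor C D} (η : PseudoNat F F') (G : TwoFunctor C D) :
    (F' ⟶ G) ⥤ PseudoNat F G :=
  TwoNat.incl F' G ⋙ precomp G.toPseudofunctor η

end Hom

/-- A functor is an isomorphism of categories. -/
def IsIsoOfCategories {X : Type u₁} [Category.{v₁} X] {Y : Type u₂} [Category.{v₂} Y]
    (Φ : X ⥤ Y) : Prop :=
  ∃ Ψ : Y ⥤ X, Φ ⋙ Ψ = 𝟭 X ∧ Ψ ⋙ Φ = 𝟭 Y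

/-! ### Pseudocolimits -/

section Pseudocolimit

variable {I : Type u₁} [Bicategory.{w₁, v₁} I] {A : Type u₂} [Bicategory.{w₂, v₂} A]

/-- A pseudocone for a 2-functor `F : I → A` with vertex `X`. -/
structure Pseudocone (F : TwoFunctor I A) (X : A) where
  leg : ∀ i : I, F.obj i ⟶ X
  cell : ∀ {i j : I} (f : i ⟶ j), leg i ≅ F.map f ≫ leg j
  cell_id : ∀ i : I, (cell (𝟙 i)).hom = (λ_ (leg i)).inv ≫ (F.mapId i).inv ▷ leg i
  cell_comp : ∀ {i j k : I} (f : i ⟶ j) (g : j ⟶ k),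
    (cell (f ≫ g)).hom = (cell f).hom ≫ F.map f ◁ (cell g).hom ≫
      (α_ (F.map f) (F.map g) (leg k)).inv ≫ (F.mapComp f g).inv ▷ leg k
  cell_naturality : ∀ {i j : I} {f g : i ⟶ j} (α : f ⟶ g),
    (cell g).hom = (cell f).hom ≫ F.map₂ α ▷ leg j

namespace Pseudocone

/-- A morphism of pseudocones with the same vertex. -/
@[ext]
structure Hom {F : TwoFunctor I A} {X : A} (θ η : Pseudocone F X) where
  app : ∀ i : I, θ.leg i ⟶ η.leg i
  naturality : ∀ {i j : I} (f : i ⟶ j),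
    app i ≫ (η.cell f).hom = (θ.cell f).hom ≫ F.map f ◁ app j

/-- The category `PC_A(F, X)` of pseudocones for `F` with vertex `X`. -/
instance (F : TwoFunctor I A) (X : A) : Category (Pseudocone F X) where
  Hom θ η := Hom θ η
  id θ := { app := fun i => 𝟙 (θ.leg i), naturality := by simp }
  comp ρ σ :=
    { app := fun i => ρ.app i ≫ σ.app i
      naturality := fun f => by
        rw [Category.assoc, σ.naturality, ← Category.assoc, ρ.naturality]
        simp }
  id_comp ρ := by apply Hom.ext; funext i; exact Category.id_comp _
  comp_id ρ := by apply Hom.ext; funext i; exact Category.comp_id _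
  assoc ρ σ τ := by apply Hom.ext; funext i; exact Category.assoc _ _ _

/-- Composing a pseudocone with vertex `L` with the 1-cells and 2-cells out of `L`. -/
def extend {F : TwoFunctor I A} {L : A} (lam : Pseudocone F L) (X : A) :
    (L ⟶ X) ⥤ Pseudocone F X where
  obj f :=
    { leg := fun i => lam.leg i ≫ f
      cell := fun u => whiskerRightIso (lam.cell u) f ≪≫ α_ _ _ _
      cell_id := fun i => by simp [lam.cell_id]
      cell_comp := fun u v => by
        simp [lam.cell_comp]
      cell_naturality := fun α => by
        simp [lam.cell_naturality α] }
  map ρ :=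
    { app := fun i => lam.leg i ◁ ρ
      naturality := fun u => by
        simp [whisker_exchange_assoc] }
  map_id f := by apply Hom.ext; funext i; exact Bicategory.whiskerLeft_id _ _
  map_comp ρ σ := by apply Hom.ext; funext i; exact Bicategory.whiskerLeft_comp _ _ _

/-- The pseudocone `lam` is a pseudocolimit: for every `X`, composition with `lam` is an
isomorphism of categories `A(L, X) ≅ PC_A(F, X)`. -/
def IsPseudocolimit {F : TwoFunctor I A} {L : A} (lam : Pseudocone F L) : Prop :=
  ∀ X : A, IsIsoOfCategories (lam.extend X)

end Pseudocone

end Pseudocolimit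

/-! ### Flexible 2-functors -/

section Flexible

open scoped Pseudofunctor.StrongTrans

attribute [local instance] uliftCategory in
/-- The inclusion 2-functor from categories with objects in `Type v` to categories with
objects in `Type (max v u)`. -/
def liftCat : TwoFunctor Cat.{v, v} Cat.{v, max v u} :=
  StrictPseudofunctor.mk''
    { obj := fun X => Cat.of (ULift.{u} X)
      map := fun f => (ULift.downFunctor ⋙ f.toFunctor ⋙ ULift.upFunctor).toCatHom
      map₂ := fun α => NatTrans.toCatHom₂ (Functor.whiskerLeft ULift.downFunctor
        (Functor.whiskerRight α.toNatTrans ULift.upFunctor))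
      map₂_id := fun _ => rfl
      map₂_comp := fun _ _ => rfl
      map_id := fun _ => rfl
      map_comp := fun _ _ => rfl
      map₂_whisker_left := fun _ _ _ _ => ((Category.id_comp _).trans (Category.comp_id _)).symm
      map₂_whisker_right := fun _ _ => ((Category.id_comp _).trans (Category.comp_id _)).symm }

variable {C : Type u} [Bicategory.{v, v} C] [Strict C]

/-- `η : F ⇒ F'` exhibits `F'` as the value at `F` of the left adjoint of the inclusion
`Hom(C, Cat) → Hom_p(C, Cat)` (with `η` as the unit): precomposition with `η` is an isomorphism
of categories `Hom(C, Cat)(F', G) ≅ Hom_p(C, Cat)(F, G)` for all `G`. -/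
def IsLeftAdjointValue {F F' : TwoFunctor C Cat.{v, max v u}} (η : PseudoNat F F') : Prop :=
  ∀ G : TwoFunctor C Cat.{v, max v u}, IsIsoOfCategories (precompPseudo η G)

/-- A 2-functor `F : C → Cat` is flexible if the counit `e : F' ⇒ F` of the adjunction
`(-)' ⊣ i` has a 2-natural section `s` with `s e ≅ id`. As `F'` has, in general, as many objects
as `C`, the adjunction is formed over the categories with objects in `Type (max v u)`; this changes
nothing if `C` is small. The counit is the 2-natural transformation determined by the triangle
identity `e η = id`. -/
def IsFlexible (F : TwoFunctor C Cat.{v, v}) : Prop :=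
  ∃ (F' : TwoFunctor C Cat.{v, max v u})
    (η : PseudoNat (F.comp liftCat.{v, u}) F') (_ : IsLeftAdjointValue η)
    (e : F' ⟶ F.comp liftCat.{v, u})
    (_ : η ≫ e.toPseudoNat = 𝟙 (F.comp liftCat.{v, u}).toPseudofunctor)
    (s : F.comp liftCat.{v, u} ⟶ F'),
    s ≫ e = 𝟙 (F.comp liftCat.{v, u}) ∧ Nonempty (e ≫ s ≅ 𝟙 F')

end Flexible

/-! ### Representable 2-functors and 2-pro-objects -/

section Representable

variable {C : Type u} [Bicategory.{v, v} C] [Strict C]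

theorem strict_whiskerRight_id {X Y : C} {h k : X ⟶ Y} (α : h ⟶ k) :
    α ▷ 𝟙 Y = eqToHom (Strict.comp_id h) ≫ α ≫ eqToHom (Strict.comp_id k).symm := by
  simp [whiskerRight_id, Strict.rightUnitor_eqToIso]

theorem strict_whiskerRight_comp {X Y Z W : C} {h k : X ⟶ Y} (α : h ⟶ k) (f : Y ⟶ Z)
    (g : Z ⟶ W) :
    α ▷ (f ≫ g) = eqToHom (Strict.assoc h f g).symm ≫ α ▷ f ▷ g ≫
      eqToHom (Strict.assoc k f g) := by
  simp [whiskerRight_comp, Strict.associator_eqToIso]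

theorem strict_whiskerLeft_whiskerLeft {X Y Z W : C} (h : X ⟶ Y) (f : Y ⟶ Z) {g k : Z ⟶ W}
    (α : g ⟶ k) :
    h ◁ f ◁ α = eqToHom (Strict.assoc h f g).symm ≫ (h ≫ f) ◁ α ≫
      eqToHom (Strict.assoc h f k) := by
  simp [comp_whiskerLeft, Strict.associator_eqToIso]

theorem strict_whiskerLeft_whiskerRight {X Y Z W : C} (h : X ⟶ Y) {f k : Y ⟶ Z} (α : f ⟶ k)
    (g : Z ⟶ W) :
    h ◁ α ▷ g = eqToHom (Strict.assoc h f g).symm ≫ (h ◁ α) ▷ g ≫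
      eqToHom (Strict.assoc h k g) := by
  simp [whisker_assoc, Strict.associator_eqToIso]

theorem strict_id_whiskerLeft {X Y : C} {h k : X ⟶ Y} (α : h ⟶ k) :
    𝟙 X ◁ α = eqToHom (Strict.id_comp h) ≫ α ≫ eqToHom (Strict.id_comp k).symm := by
  simp [id_whiskerLeft, Strict.leftUnitor_eqToIso]

theorem strict_comp_whiskerLeft {X Y Z W : C} (f : X ⟶ Y) (g : Y ⟶ Z) {h k : Z ⟶ W}
    (α : h ⟶ k) :
    (f ≫ g) ◁ α = eqToHom (Strict.assoc f g h) ≫ f ◁ g ◁ α ≫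
      eqToHom (Strict.assoc f g k).symm := by
  simp [comp_whiskerLeft, Strict.associator_eqToIso]

theorem strict_whiskerRight_whiskerRight {X Y Z W : C} {f g : X ⟶ Y} (α : f ⟶ g) (k : Y ⟶ Z)
    (h : Z ⟶ W) :
    α ▷ k ▷ h = eqToHom (Strict.assoc f k h) ≫ α ▷ (k ≫ h) ≫
      eqToHom (Strict.assoc g k h).symm := by
  simp [whiskerRight_comp, Strict.associator_eqToIso]

theorem strict_whiskerLeft_whiskerRight' {X Y Z W : C} (f : X ⟶ Y) {g k : Y ⟶ Z} (α : g ⟶ k)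
    (h : Z ⟶ W) :
    (f ◁ α) ▷ h = eqToHom (Strict.assoc f g h) ≫ f ◁ α ▷ h ≫
      eqToHom (Strict.assoc f k h).symm := by
  simp [whisker_assoc, Strict.associator_eqToIso]

theorem cat_eqToHom_app {X Y : Cat.{w₁, u₁}} {F G : X ⟶ Y} (h : F = G) (x : X) :
    (eqToHom h).toNatTrans.app x = eqToHom (by rw [h]) := by
  subst h
  rfl

theorem cat_conj_app {X Y : Cat.{w₁, u₁}} {F G H K : X ⟶ Y} (h : F = G) (β : G ⟶ H)
    (h' : H = K) (x : X) :
    (eqToHom h ≫ β ≫ eqToHom h').toNatTrans.app x =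
      eqToHom (by rw [h]) ≫ β.toNatTrans.app x ≫ eqToHom (by rw [h']) := by
  subst h h'
  simp

/-- Two 2-cells of `Cat` form a commutative square with 2-cells given by equalities if they do so
pointwise. -/
theorem cat_square {X Y : Cat.{w₁, u₁}} {F G H K : X ⟶ Y} (α : F ⟶ G) (h : G = H) (h' : F = K)
    (β : K ⟶ H)
    (w : ∀ x : X, α.toNatTrans.app x = eqToHom (by rw [h']) ≫ β.toNatTrans.app x ≫
      eqToHom (by rw [h])) :
    α ≫ eqToHom h = eqToHom h' ≫ β := by
  subst h h'
  apply Cat.Hom₂.ext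
  ext x
  simpa using w x

/-- The representable 2-functor `C(X, -) : C → Cat`. -/
def rep (X : C) : TwoFunctor C Cat.{v, v} :=
  StrictPseudofunctor.mk''
    { obj := fun Y => Cat.of (X ⟶ Y)
      map := fun f => (postcomp X f).toCatHom
      map₂ := fun α => NatTrans.toCatHom₂ ((postcomposing X _ _).map α)
      map₂_id := fun f => by
        apply Cat.Hom₂.ext; ext h; exact whiskerLeft_id _ _
      map₂_comp := fun α β => by
        apply Cat.Hom₂.ext; ext h; exact whiskerLeft_comp _ _ _
      map_id := fun Y => Cat.Hom.ext
        (CategoryTheory.Functor.ext (fun h => Strict.comp_id h)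
          fun _ _ α => strict_whiskerRight_id α)
      map_comp := fun f g => Cat.Hom.ext
        (CategoryTheory.Functor.ext (fun h => (Strict.assoc h f g).symm)
          fun _ _ α => strict_whiskerRight_comp α f g)
      map₂_whisker_left := fun f g g' α => by
        apply Cat.Hom₂.ext; ext h
        refine Eq.trans ?_ (cat_conj_app _ _ _ h).symm
        exact strict_whiskerLeft_whiskerLeft (X := X) h f α
      map₂_whisker_right := fun α g => by
        apply Cat.Hom₂.ext; ext h
        refine Eq.trans ?_ (cat_conj_app _ _ _ h).symm
        exact strict_whiskerLeft_whiskerRight (X := X) h α g }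

/-- The 2-natural transformation `f^* : C(Y, -) ⇒ C(X, -)` given by precomposition. -/
def repMap {X Y : C} (f : X ⟶ Y) : rep Y ⟶ rep X :=
  TwoNat.mk' (fun Z => (precomp Z f).toCatHom)
    (fun g => Cat.Hom.ext
      (CategoryTheory.Functor.ext (fun h => (Strict.assoc f h g).symm)
        fun _ _ α => strict_whiskerLeft_whiskerRight f α g))
    (fun α => cat_square _ _ _ _ fun h => strict_whiskerLeft_whiskerLeft f h α)

/-- The modification `α^* : f^* ⇒ g^*` given by precomposition. -/
def repMap₂ {X Y : C} {f g : X ⟶ Y} (α : f ⟶ g) : repMap f ⟶ repMap g where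
  mod :=
    { as :=
        { app := fun Z => NatTrans.toCatHom₂ ((precomposing X Y Z).map α)
          naturality := fun k => by
            refine cat_square _ ((repMap g).comm k) ((repMap f).comm k) _ fun h => ?_
            exact strict_whiskerRight_comp α h k } }

theorem repMap₂_id {X Y : C} (f : X ⟶ Y) : repMap₂ (𝟙 f) = 𝟙 (repMap f) :=
  hom_ext fun Z => by
    apply Cat.Hom₂.ext; ext h; exact id_whiskerRight f h

theorem repMap₂_comp {X Y : C} {f g k : X ⟶ Y} (α : f ⟶ g) (β : g ⟶ k) :
    repMap₂ (α ≫ β) = repMap₂ α ≫ repMap₂ β :=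
  hom_ext fun Z => by
    apply Cat.Hom₂.ext; ext h; exact comp_whiskerRight α β h

theorem repMap_id (X : C) : repMap (𝟙 X) = 𝟙 (rep X) :=
  TwoNat.ext_app fun Z => Cat.Hom.ext (CategoryTheory.Functor.ext (fun h => Strict.id_comp h)
    fun _ _ α => by
      refine (strict_id_whiskerLeft (X := X) (Y := Z) α).trans ?_
      rfl)

theorem repMap_comp {X Y Z : C} (f : X ⟶ Y) (g : Y ⟶ Z) :
    repMap (f ≫ g) = repMap g ≫ repMap f :=
  TwoNat.ext_app fun W => Cat.Hom.ext (CategoryTheory.Functor.ext (fun h => Strict.assoc f g h)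
    fun _ _ α => by
      refine (strict_comp_whiskerLeft (W := W) f g α).trans ?_
      rfl)

theorem repMap₂_eqToHom {X Y : C} {f g : X ⟶ Y} (h : f = g) :
    repMap₂ (eqToHom h) = eqToHom (congrArg repMap h) := by
  subst h
  exact repMap₂_id f

theorem repMap₂_whiskerRight {X Y Z : C} {f g : X ⟶ Y} (α : f ⟶ g) (k : Y ⟶ Z) :
    repMap₂ (α ▷ k) = eqToHom (repMap_comp f k) ≫ (repMap k ◁ repMap₂ α) ≫
      eqToHom (repMap_comp g k).symm := by
  refine hom_ext fun W => ?_
  refine Eq.trans ?_ (hom_conj_app _ _ _ W).symm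
  apply Cat.Hom₂.ext
  ext h
  refine Eq.trans ?_ (cat_conj_app _ _ _ h).symm
  exact strict_whiskerRight_whiskerRight α k h

theorem repMap₂_whiskerLeft {X Y Z : C} (f : X ⟶ Y) {g k : Y ⟶ Z} (α : g ⟶ k) :
    repMap₂ (f ◁ α) = eqToHom (repMap_comp f g) ≫ (repMap₂ α ▷ repMap f) ≫
      eqToHom (repMap_comp f k).symm := by
  refine hom_ext fun W => ?_
  refine Eq.trans ?_ (hom_conj_app _ _ _ W).symm
  apply Cat.Hom₂.ext
  ext h
  refine Eq.trans ?_ (cat_conj_app _ _ _ h).symm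
  exact strict_whiskerLeft_whiskerRight' f α h

variable {I : Type u₁} [Bicategory.{w₁, v₁} I] [Strict I]

/-- For a 2-functor `X : I^op → C`, the 2-functor `I → Hom(C, Cat)`, `i ↦ C(X_i, -)`. -/
def repDiagram (X : TwoFunctor Iᵒᵖ C) : TwoFunctor I (TwoFunctor C Cat.{v, v}) :=
  StrictPseudofunctor.mk''
    { obj := fun i => rep (X.obj (op i))
      map := fun f => repMap (X.map f.op)
      map₂ := fun α => repMap₂ (X.map₂ (Bicategory.Opposite.op2 α))
      map₂_id := fun f => by
        rw [Bicategory.Opposite.op2_id, X.map₂_id]; exact repMap₂_id _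
      map₂_comp := fun α β => by
        rw [Bicategory.Opposite.op2_comp, X.map₂_comp]; exact repMap₂_comp _ _
      map_id := fun i => by
        rw [op_id, X.map_id]; exact repMap_id _
      map_comp := fun f g => by
        rw [op_comp, X.map_comp]; exact repMap_comp _ _
      map₂_whisker_left := fun f g g' α => by
        rw [Bicategory.Opposite.op2_whiskerLeft, X.map₂_whisker_right, X.mapComp_eq_eqToIso,
          X.mapComp_eq_eqToIso]
        simp [repMap₂_comp, repMap₂_eqToHom, repMap₂_whiskerRight]
      map₂_whisker_right := fun α g => by
        rw [Bicategory.Opposite.op2_whiskerRight, X.map₂_whisker_left, X.mapComp_eq_eqToIso,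
          X.mapComp_eq_eqToIso]
        simp [repMap₂_comp, repMap₂_eqToHom, repMap₂_whiskerLeft] }

/-- A 2-functor `C → Cat` is representable if it is isomorphic, in the 2-category `Hom(C, Cat)`,
to some `C(X, -)`. -/
def IsRepresentable (F : TwoFunctor C Cat.{v, v}) : Prop :=
  ∃ (X : C) (φ : rep X ⟶ F) (ψ : F ⟶ rep X), φ ≫ ψ = 𝟙 (rep X) ∧ ψ ≫ φ = 𝟙 F

/-- A 2-category is 2-filtered if
(F0) any two objects `i`, `j` admit arrows `i → k` and `j → k` to a common object;
(F1) for any two parallel arrows `f`, `g` there are an arrow `h` and an invertible 2-cell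
`h f ≅ h g`;
(F2) for any two parallel 2-cells `α`, `β` there is an arrow `h` with `h α = h β`. -/
structure IsTwoFiltered (I : Type u₁) [Bicategory.{w₁, v₁} I] : Prop where
  exists_cocone : ∀ i j : I, ∃ k : I, Nonempty (i ⟶ k) ∧ Nonempty (j ⟶ k)
  exists_iso : ∀ {i j : I} (f g : i ⟶ j), ∃ (k : I) (h : j ⟶ k), Nonempty (f ≫ h ≅ g ≫ h)
  exists_eq : ∀ {i j : I} {f g : i ⟶ j} (α β : f ⟶ g),
    ∃ (k : I) (h : j ⟶ k), α ▷ h = β ▷ h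

/-- A 2-pro-object of the 2-category `C`: a 2-functor `I^op → C`, with `I` a small 2-filtered
2-category. -/
structure TwoProObject (C : Type u) [Bicategory.{v, v} C] where
  Index : Type v
  [bicategory : Bicategory.{v, v} Index]
  [strict : Strict Index]
  filtered : IsTwoFiltered Index
  diagram : TwoFunctor Indexᵒᵖ C

attribute [instance] TwoProObject.bicategory TwoProObject.strict

/-- `L` is the 2-functor associated with the 2-pro-object `X = (X_i)`: it is a pseudocolimit in
`Hom(C, Cat)` of the 2-functor `i ↦ C(X_i, -)`. -/
def TwoProObject.IsAssociated (X : TwoProObject C) (L : TwoFunctor C Cat.{v, v}) : Prop :=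
  ∃ lam : Pseudocone (repDiagram X.diagram) L, lam.IsPseudocolimit

end Representable

end TwoCat

/-! The value `strictify F` of the left adjoint has an explicit model: an object over `X` is a
triple of an object `A`, an arrow `A ⟶ X` and an object `x` of `F A`, and its morphisms are those of
`F X` between the images of the `x`'s. `C` acts strictly, by composition on the arrow, and the
counit is pointwise fully faithful. The unit `x ↦ (A, 𝟙 A, x)` is a pseudonatural section of the
counit, hence a pseudo-inverse. Every `(A, f, x)` is obtained by letting `f` act on `(A, 𝟙 A, x)`,
so a pseudonatural transformation out of `F` extends to exactly one 2-natural transformation out of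
`strictify F` (`isLeftAdjointValue_unit`).

Since the counit is fully faithful, any 2-natural section `s` of it satisfies `e ≫ s ≅ 𝟙`
automatically. Flexibility is thus the existence of a strict section (`isFlexible_of_section`), and
by full faithfulness a strict lift along the counit only has to be chosen on objects, compatibly
with the action of `C`.

Flexible and representable 2-functors share the property `LiftsAlongCounit`: every 2-natural
transformation from them to `L` lifts strictly through the counit at `L`. For a flexible one,
transpose the lift given by the unit and precompose with the section; for `C(X, -)`, use the Yoneda
lemma.

For a pseudocolimit `L`, let `P` be the full image of the legs: its objects are pairs of an index
`i` and an object of `F i`, its morphisms those of `L`. The legs factor strictly through `P ⟶ L`,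
and the cells of the pseudocone lift by full faithfulness, so the universal property gives a strict
section `L ⟶ P` (`exists_section_legObjects`). As the objects of `P` are a disjoint union over `i`,
lifts of the separate legs to the strictification of `L` glue to a lift of `P ⟶ L`, with no
compatibility in `i`. Composing gives the section sought. Passing through `P` also settles size: `P`
has small fibres, so the universal property of `L` applies to it, while the strictification of `L`
may have as many objects as `C`. -/

namespace TwoCat

universe w₁ w₂ v₁ v₂ u₁ u₂

section FullImage

variable {C : Type u₁} [Bicategory.{w₁, v₁} C]

/-! ### 2-functors to `Cat`, elementwise -/

namespace CatValued

variable (G : TwoFunctor C Cat.{w₂, u₂})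

theorem map_id_obj (X : C) (x : G.obj X) : (G.map (𝟙 X)).toFunctor.obj x = x := by
  rw [G.map_id]; rfl

theorem map_comp_obj {X Y Z : C} (f : X ⟶ Y) (g : Y ⟶ Z) (x : G.obj X) :
    (G.map (f ≫ g)).toFunctor.obj x = (G.map g).toFunctor.obj ((G.map f).toFunctor.obj x) := by
  rw [G.map_comp]; rfl

/-- Stated for arbitrary 1-cells so that the equality can be substituted away, which is impossible
for the functoriality equations of a given `G`. -/
theorem map_congr {X Y : Cat.{w₂, u₂}} {h k : X ⟶ Y} (e : h = k) {x y : X} (u : x ⟶ y) :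
    h.toFunctor.map u = eqToHom (by rw [e]) ≫ k.toFunctor.map u ≫ eqToHom (by rw [e]) := by
  subst e; simp

theorem map_id_map (X : C) {x y : G.obj X} (u : x ⟶ y) :
    (G.map (𝟙 X)).toFunctor.map u =
      eqToHom (map_id_obj G X x) ≫ u ≫ eqToHom (map_id_obj G X y).symm :=
  map_congr (G.map_id X) u

theorem map_comp_map {X Y Z : C} (f : X ⟶ Y) (g : Y ⟶ Z) {x y : G.obj X} (u : x ⟶ y) :
    (G.map (f ≫ g)).toFunctor.map u = eqToHom (map_comp_obj G f g x) ≫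
      (G.map g).toFunctor.map ((G.map f).toFunctor.map u) ≫
        eqToHom (map_comp_obj G f g y).symm :=
  map_congr (G.map_comp f g) u

@[simp]
theorem mapComp_hom_app {X Y Z : C} (f : X ⟶ Y) (g : Y ⟶ Z) (x : G.obj X) :
    (G.mapComp f g).hom.toNatTrans.app x = eqToHom (map_comp_obj G f g x) := by
  rw [G.mapComp_eq_eqToIso]
  simp

@[simp]
theorem mapComp_inv_app {X Y Z : C} (f : X ⟶ Y) (g : Y ⟶ Z) (x : G.obj X) :
    (G.mapComp f g).inv.toNatTrans.app x = eqToHom (map_comp_obj G f g x).symm := by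
  rw [G.mapComp_eq_eqToIso]
  simp

@[simp]
theorem mapId_hom_app (X : C) (x : G.obj X) :
    (G.mapId X).hom.toNatTrans.app x = eqToHom (map_id_obj G X x) := by
  rw [G.mapId_eq_eqToIso]
  simp

end CatValued

theorem natTrans_app_congr {X Y : Cat.{w₂, u₂}} {F G : X ⟶ Y} (α : F ⟶ G) {x y : X} (h : x = y) :
    α.toNatTrans.app x = eqToHom (by rw [h]) ≫ α.toNatTrans.app y ≫ eqToHom (by rw [h]) := by
  subst h; simp

/-! ### Full images -/

/-- Sets of objects over a 2-functor `L : C → Cat`, with a strict action of the arrows of `C`. -/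
structure ObjectsOver (L : TwoFunctor C Cat.{w₂, u₂}) where
  carrier : C → Type u₂
  act : ∀ {X Y : C}, (X ⟶ Y) → carrier X → carrier Y
  act_id : ∀ (X : C) (t : carrier X), act (𝟙 X) t = t
  act_comp : ∀ {X Y Z : C} (f : X ⟶ Y) (g : Y ⟶ Z) (t : carrier X),
    act (f ≫ g) t = act g (act f t)
  proj : ∀ {X : C}, carrier X → L.obj X
  proj_act : ∀ {X Y : C} (f : X ⟶ Y) (t : carrier X),
    proj (act f t) = (L.map f).toFunctor.obj (proj t)

namespace ObjectsOver

variable {L : TwoFunctor C Cat.{w₂, u₂}} (T : ObjectsOver L)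

/-- The category with objects `T X` and morphisms those of `L X`. -/
abbrev Fiber (X : C) : Type u₂ := InducedCategory (L.obj X) (T.proj (X := X))

theorem fiber_hom_ext {X : C} {s t : T.Fiber X} {a b : s ⟶ t} (h : a.hom = b.hom) : a = b :=
  InducedCategory.Hom.ext h

theorem eqToHom_hom {X : C} {s t : T.Fiber X} (h : s = t) :
    (eqToHom h).hom = eqToHom (congrArg (T.proj (X := X)) h) := by
  subst h; rfl

theorem conj_hom {X : C} {s t s' t' : T.Fiber X} (h : s = t) (a : t ⟶ s') (h' : s' = t') :
    (eqToHom h ≫ a ≫ eqToHom h').hom = eqToHom (congrArg (T.proj (X := X)) h) ≫ a.hom ≫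
      eqToHom (congrArg (T.proj (X := X)) h') := by
  subst h h'; simp

/-- The action of an arrow of `C` on the full image. -/
def fiberMap {X Y : C} (f : X ⟶ Y) : T.Fiber X ⥤ T.Fiber Y where
  obj t := T.act f t
  map {s t} u := InducedCategory.homMk
    (eqToHom (T.proj_act f s) ≫ (L.map f).toFunctor.map u.hom ≫ eqToHom (T.proj_act f t).symm)
  map_id t := T.fiber_hom_ext (by simp)
  map_comp a b := T.fiber_hom_ext (by simp)

/-- The action of a 2-cell of `C` on the full image. -/
def fiberMap₂ {X Y : C} {f g : X ⟶ Y} (α : f ⟶ g) : T.fiberMap f ⟶ T.fiberMap g where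
  app t := InducedCategory.homMk
    (eqToHom (T.proj_act f t) ≫ (L.map₂ α).toNatTrans.app (T.proj t) ≫
      eqToHom (T.proj_act g t).symm)
  naturality s t u := T.fiber_hom_ext (by simp [fiberMap])

variable [Strict C]

/-- The full image of `T` in `L`: the objects are those of `T`, the morphisms those of `L`. -/
def fullImage : TwoFunctor C Cat.{w₂, u₂} :=
  StrictPseudofunctor.mk''
    { obj := fun X => Cat.of (T.Fiber X)
      map := fun f => (T.fiberMap f).toCatHom
      map₂ := fun α => (T.fiberMap₂ α).toCatHom₂
      map₂_id := fun f => by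
        apply Cat.Hom₂.ext; ext t
        refine T.fiber_hom_ext ?_
        change (_ : _ ⟶ _) = 𝟙 _
        simp [fiberMap, fiberMap₂]
      map₂_comp := fun α β => by
        apply Cat.Hom₂.ext; ext t
        refine T.fiber_hom_ext ?_
        change (_ : _ ⟶ _) = ((T.fiberMap₂ α).app t).hom ≫ ((T.fiberMap₂ β).app t).hom
        simp [fiberMap, fiberMap₂]
      map_id := fun X => Cat.Hom.ext (CategoryTheory.Functor.ext (fun t => T.act_id X t)
        fun s t u => T.fiber_hom_ext (by
          refine Eq.trans ?_ (T.conj_hom (T.act_id X s) u (T.act_id X t).symm).symm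
          simp [fiberMap, CatValued.map_id_map]))
      map_comp := fun f g => Cat.Hom.ext (CategoryTheory.Functor.ext (fun t => T.act_comp f g t)
        fun s t u => T.fiber_hom_ext (by
          refine Eq.trans ?_ (T.conj_hom (T.act_comp f g s)
            ((T.fiberMap g).map ((T.fiberMap f).map u)) (T.act_comp f g t).symm).symm
          simp [fiberMap, CatValued.map_comp_map, eqToHom_map]
          erw [eqToHom_trans]))
      map₂_whisker_left := fun f g g' α => by
        apply Cat.Hom₂.ext; ext t
        refine Eq.trans ?_ (cat_conj_app _ _ _ t).symm
        refine T.fiber_hom_ext ?_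
        refine Eq.trans ?_ (T.conj_hom _ ((T.fiberMap₂ α).app (T.act f t)) _).symm
        simp [fiberMap, fiberMap₂, natTrans_app_congr (L.map₂ α) (T.proj_act f t)]
        erw [eqToHom_trans, eqToHom_trans_assoc]
      map₂_whisker_right := fun α g => by
        apply Cat.Hom₂.ext; ext t
        refine Eq.trans ?_ (cat_conj_app _ _ _ t).symm
        refine T.fiber_hom_ext ?_
        refine Eq.trans ?_ (T.conj_hom _ ((T.fiberMap g).map ((T.fiberMap₂ α).app t)) _).symm
        simp [fiberMap, fiberMap₂, eqToHom_map]
        erw [eqToHom_trans, eqToHom_trans_assoc] }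

/-- The inclusion of the full image. -/
def incl : T.fullImage ⟶ L :=
  TwoNat.mk' (fun X => (inducedFunctor (T.proj (X := X))).toCatHom)
    (fun f => Cat.Hom.ext (CategoryTheory.Functor.ext (fun t => T.proj_act f t)
      fun _ _ _ => rfl))
    (fun _ => cat_square _ _ _ _ fun _ => rfl)

end ObjectsOver

end FullImage

section EqToHom

/-! ### Morphisms given by equalities -/

/-- A morphism given by an equality of objects. -/
def IsEqToHom {X : Type u₁} [Category.{v₁} X] {x y : X} (a : x ⟶ y) : Prop :=
  ∃ e : x = y, a = eqToHom e

namespace IsEqToHom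

variable {X : Type u₁} [Category.{v₁} X] {Y : Type u₂} [Category.{v₂} Y]

theorem eqToHom {x y : X} (h : x = y) : IsEqToHom (CategoryTheory.eqToHom h) := ⟨h, rfl⟩

theorem congr {x y : X} {a b : x ⟶ y} (h : a = b) (hb : IsEqToHom b) : IsEqToHom a :=
  h ▸ hb

theorem comp {x y z : X} {a : x ⟶ y} {b : y ⟶ z} (ha : IsEqToHom a) (hb : IsEqToHom b) :
    IsEqToHom (a ≫ b) := by
  obtain ⟨rfl, rfl⟩ := ha
  obtain ⟨rfl, rfl⟩ := hb
  exact ⟨rfl, by simp⟩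

theorem of_comp {x y z : X} {a : x ⟶ y} {b : y ⟶ z} (hb : IsEqToHom b)
    (h : IsEqToHom (a ≫ b)) : IsEqToHom a := by
  obtain ⟨rfl, rfl⟩ := hb
  simpa using h

/-- By proof irrelevance, this closes any coherence goal whose two sides are built from equalities,
without computing either side. -/
theorem eq {x y : X} {a b : x ⟶ y} (ha : IsEqToHom a) (hb : IsEqToHom b) : a = b :=
  ha.2.trans hb.2.symm

theorem map (F : X ⥤ Y) {x y : X} {a : x ⟶ y} (ha : IsEqToHom a) : IsEqToHom (F.map a) := by
  obtain ⟨rfl, rfl⟩ := ha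
  exact ⟨rfl, by simp⟩

end IsEqToHom

end EqToHom

section Modifications

open scoped Pseudofunctor.StrongTrans

variable {C : Type u₁} [Bicategory.{w₁, v₁} C]

/-! ### Pseudonatural transformations between `Cat`-valued 2-functors, elementwise -/

namespace PseudoNat

variable {F G H : TwoFunctor C Cat.{w₂, u₂}}

/-- The component at `f` and `x` of the structural 2-cell of a pseudonatural transformation. -/
abbrev cell (θ : PseudoNat F G) {X Y : C} (f : X ⟶ Y) (x : F.obj X) :
    (θ.app Y).toFunctor.obj ((F.map f).toFunctor.obj x) ⟶
      (G.map f).toFunctor.obj ((θ.app X).toFunctor.obj x) :=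
  (θ.naturality f).hom.toNatTrans.app x

/-- The component at `f` and `x` of the structural 2-cell, as an isomorphism. -/
abbrev cellIso (θ : PseudoNat F G) {X Y : C} (f : X ⟶ Y) (x : F.obj X) :
    (θ.app Y).toFunctor.obj ((F.map f).toFunctor.obj x) ≅
      (G.map f).toFunctor.obj ((θ.app X).toFunctor.obj x) :=
  (Cat.Hom.toNatIso (θ.naturality f)).app x

instance (θ : PseudoNat F G) {X Y : C} (f : X ⟶ Y) (x : F.obj X) : IsIso (cell θ f x) :=
  inferInstanceAs (IsIso ((Cat.Hom.toNatIso (θ.naturality f)).hom.app x))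

theorem cell_naturality (θ : PseudoNat F G) {X Y : C} (f : X ⟶ Y) {x y : F.obj X} (a : x ⟶ y) :
    (θ.app Y).toFunctor.map ((F.map f).toFunctor.map a) ≫ cell θ f y =
      cell θ f x ≫ (G.map f).toFunctor.map ((θ.app X).toFunctor.map a) :=
  (θ.naturality f).hom.toNatTrans.naturality a

theorem cell_naturality_assoc (θ : PseudoNat F G) {X Y : C} (f : X ⟶ Y) {x y : F.obj X}
    (a : x ⟶ y) {z : G.obj Y}
    (b : (G.map f).toFunctor.obj ((θ.app X).toFunctor.obj y) ⟶ z) :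
    (θ.app Y).toFunctor.map ((F.map f).toFunctor.map a) ≫ cell θ f y ≫ b =
      cell θ f x ≫ (G.map f).toFunctor.map ((θ.app X).toFunctor.map a) ≫ b := by
  rw [← Category.assoc, cell_naturality, Category.assoc]

theorem cell_map₂ (θ : PseudoNat F G) {X Y : C} {f g : X ⟶ Y} (α : f ⟶ g) (x : F.obj X) :
    (θ.app Y).toFunctor.map ((F.map₂ α).toNatTrans.app x) ≫ cell θ g x =
      cell θ f x ≫ (G.map₂ α).toNatTrans.app ((θ.app X).toFunctor.obj x) :=
  congrArg (fun t => t.toNatTrans.app x) (θ.naturality_naturality α)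

theorem cell_map₂_assoc (θ : PseudoNat F G) {X Y : C} {f g : X ⟶ Y} (α : f ⟶ g) (x : F.obj X)
    {z : G.obj Y} (b : (G.map g).toFunctor.obj ((θ.app X).toFunctor.obj x) ⟶ z) :
    (θ.app Y).toFunctor.map ((F.map₂ α).toNatTrans.app x) ≫ cell θ g x ≫ b =
      cell θ f x ≫ (G.map₂ α).toNatTrans.app ((θ.app X).toFunctor.obj x) ≫ b := by
  rw [← Category.assoc, cell_map₂, Category.assoc]

theorem cell_id (θ : PseudoNat F G) (X : C) (x : F.obj X) :
    cell θ (𝟙 X) x = eqToHom (by rw [CatValued.map_id_obj, CatValued.map_id_obj]) := by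
  have h := congrArg (fun t => t.toNatTrans.app x) (θ.naturality_id X)
  -- The unitors of `Cat` have identity components, which appear here as `𝟙 _`.
  change cell θ (𝟙 X) x ≫ (G.mapId X).hom.toNatTrans.app _ =
    (θ.app X).toFunctor.map ((F.mapId X).hom.toNatTrans.app x) ≫ 𝟙 _ ≫ 𝟙 _ at h
  rw [CatValued.mapId_hom_app, CatValued.mapId_hom_app, eqToHom_map, Category.comp_id,
    Category.comp_id] at h
  rw [comp_eqToHom_iff] at h
  simpa using h

theorem cell_comp (θ : PseudoNat F G) {X Y Z : C} (f : X ⟶ Y) (g : Y ⟶ Z) (x : F.obj X) :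
    cell θ (f ≫ g) x = eqToHom (by rw [CatValued.map_comp_obj]) ≫
      cell θ g ((F.map f).toFunctor.obj x) ≫ (G.map g).toFunctor.map (cell θ f x) ≫
        eqToHom (CatValued.map_comp_obj G f g _).symm := by
  have h := congrArg (fun t => t.toNatTrans.app x) (θ.naturality_comp f g)
  change cell θ (f ≫ g) x ≫ (G.mapComp f g).hom.toNatTrans.app _ =
    (θ.app Z).toFunctor.map ((F.mapComp f g).hom.toNatTrans.app x) ≫ 𝟙 _ ≫
      cell θ g ((F.map f).toFunctor.obj x) ≫ 𝟙 _ ≫ (G.map g).toFunctor.map (cell θ f x) ≫ 𝟙 _ at h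
  rw [CatValued.mapComp_hom_app, CatValued.mapComp_hom_app, eqToHom_map] at h
  simp only [Category.id_comp, Category.comp_id] at h
  rw [comp_eqToHom_iff] at h
  simpa using h

theorem comp_cell (θ : PseudoNat F G) (ζ : PseudoNat G H) {X Y : C} (f : X ⟶ Y) (x : F.obj X) :
    cell (θ ≫ ζ : PseudoNat F H) f x =
      (ζ.app Y).toFunctor.map (cell θ f x) ≫ cell ζ f ((θ.app X).toFunctor.obj x) := by
  change 𝟙 _ ≫ (ζ.app Y).toFunctor.map (cell θ f x) ≫ 𝟙 _ ≫
    cell ζ f ((θ.app X).toFunctor.obj x) ≫ 𝟙 _ = _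
  simp only [Category.id_comp, Category.comp_id]

/-- Constructor for pseudonatural transformations, elementwise. -/
def mk' (app : ∀ X : C, F.obj X ⟶ G.obj X)
    (cell : ∀ {X Y : C} (f : X ⟶ Y) (x : F.obj X),
      (app Y).toFunctor.obj ((F.map f).toFunctor.obj x) ≅
        (G.map f).toFunctor.obj ((app X).toFunctor.obj x))
    (cell_naturality : ∀ {X Y : C} (f : X ⟶ Y) {x y : F.obj X} (a : x ⟶ y),
      (app Y).toFunctor.map ((F.map f).toFunctor.map a) ≫ (cell f y).hom =
        (cell f x).hom ≫ (G.map f).toFunctor.map ((app X).toFunctor.map a))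
    (cell_map₂ : ∀ {X Y : C} {f g : X ⟶ Y} (α : f ⟶ g) (x : F.obj X),
      (app Y).toFunctor.map ((F.map₂ α).toNatTrans.app x) ≫ (cell g x).hom =
        (cell f x).hom ≫ (G.map₂ α).toNatTrans.app ((app X).toFunctor.obj x))
    (cell_id : ∀ (X : C) (x : F.obj X), (cell (𝟙 X) x).hom =
      eqToHom (by rw [CatValued.map_id_obj, CatValued.map_id_obj]))
    (cell_comp : ∀ {X Y Z : C} (f : X ⟶ Y) (g : Y ⟶ Z) (x : F.obj X),
      (cell (f ≫ g) x).hom = eqToHom (by rw [CatValued.map_comp_obj]) ≫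
        (cell g ((F.map f).toFunctor.obj x)).hom ≫ (G.map g).toFunctor.map (cell f x).hom ≫
          eqToHom (CatValued.map_comp_obj G f g _).symm) :
    PseudoNat F G where
  app := app
  naturality {X Y} f := Cat.Hom.isoMk
    (F := (F.map f).toFunctor ⋙ (app Y).toFunctor) (G := (app X).toFunctor ⋙ (G.map f).toFunctor)
    (NatIso.ofComponents (fun x => cell f x) (fun a => cell_naturality f a))
  naturality_naturality α := by
    apply Cat.Hom₂.ext; ext x
    exact cell_map₂ α x
  naturality_id X := by
    apply Cat.Hom₂.ext; ext x
    change (cell (𝟙 X) x).hom ≫ (G.mapId X).hom.toNatTrans.app _ =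
      (app X).toFunctor.map ((F.mapId X).hom.toNatTrans.app x) ≫ 𝟙 _ ≫ 𝟙 _
    simp [cell_id, eqToHom_map]
  naturality_comp {X Y Z} f g := by
    apply Cat.Hom₂.ext; ext x
    change (cell (f ≫ g) x).hom ≫ (G.mapComp f g).hom.toNatTrans.app _ =
      (app Z).toFunctor.map ((F.mapComp f g).hom.toNatTrans.app x) ≫ 𝟙 _ ≫
        (cell g ((F.map f).toFunctor.obj x)).hom ≫ 𝟙 _ ≫
          (G.map g).toFunctor.map (cell f x).hom ≫ 𝟙 _
    rw [cell_comp, CatValued.mapComp_hom_app, CatValued.mapComp_hom_app, eqToHom_map]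
    simp

/-- The component of a modification. -/
abbrev modApp {θ ζ : PseudoNat F G} (ρ : θ ⟶ ζ) (X : C) (x : F.obj X) :
    (θ.app X).toFunctor.obj x ⟶ (ζ.app X).toFunctor.obj x :=
  (ρ.as.app X).toNatTrans.app x

theorem modApp_naturality {θ ζ : PseudoNat F G} (ρ : θ ⟶ ζ) (X : C) {x y : F.obj X} (a : x ⟶ y) :
    (θ.app X).toFunctor.map a ≫ modApp ρ X y = modApp ρ X x ≫ (ζ.app X).toFunctor.map a :=
  (ρ.as.app X).toNatTrans.naturality a

theorem modApp_cell {θ ζ : PseudoNat F G} (ρ : θ ⟶ ζ) {X Y : C} (f : X ⟶ Y) (x : F.obj X) :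
    modApp ρ Y ((F.map f).toFunctor.obj x) ≫ cell ζ f x =
      cell θ f x ≫ (G.map f).toFunctor.map (modApp ρ X x) :=
  congrArg (fun t => t.toNatTrans.app x) (ρ.as.naturality f)

/-- Constructor for modifications, elementwise. -/
def modMk {θ ζ : PseudoNat F G}
    (app : ∀ (X : C) (x : F.obj X), (θ.app X).toFunctor.obj x ⟶ (ζ.app X).toFunctor.obj x)
    (naturality : ∀ (X : C) {x y : F.obj X} (a : x ⟶ y),
      (θ.app X).toFunctor.map a ≫ app X y = app X x ≫ (ζ.app X).toFunctor.map a)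
    (cell_app : ∀ {X Y : C} (f : X ⟶ Y) (x : F.obj X),
      app Y ((F.map f).toFunctor.obj x) ≫ cell ζ f x =
        cell θ f x ≫ (G.map f).toFunctor.map (app X x)) : θ ⟶ ζ where
  as :=
    { app := fun X => Cat.Hom₂.ofNatTrans
        { app := fun x => app X x
          naturality := fun _ _ a => naturality X a }
      naturality := fun f => by
        apply Cat.Hom₂.ext; ext x
        exact cell_app f x }

theorem mod_ext {θ ζ : PseudoNat F G} {ρ τ : θ ⟶ ζ}
    (h : ∀ (X : C) (x : F.obj X), modApp ρ X x = modApp τ X x) : ρ = τ := by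
  apply Pseudofunctor.StrongTrans.homCategory.ext
  intro X
  apply Cat.Hom₂.ext; ext x
  exact h X x

/-! ### Lifting modifications along pointwise fully faithful transformations -/

/-- A pseudonatural transformation is fully faithful if its components are. -/
def FullyFaithful (p : PseudoNat F G) : Prop :=
  ∀ X, (p.app X).toFunctor.Full ∧ (p.app X).toFunctor.Faithful

variable {p : PseudoNat G H}

theorem FullyFaithful.mod_ext (hp : FullyFaithful p) {θ ζ : PseudoNat F G} {ρ τ : θ ⟶ ζ}
    (h : ρ ▷ p = τ ▷ p) : ρ = τ :=
  PseudoNat.mod_ext fun X x => by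
    have := (hp X).2
    exact (p.app X).toFunctor.map_injective (congrArg (fun t => modApp t X x) h)

/-- The lift of a modification along a fully faithful transformation. -/
theorem FullyFaithful.exists_lift (hp : FullyFaithful p) {θ ζ : PseudoNat F G}
    (τ : (θ ≫ p : PseudoNat F H) ⟶ ζ ≫ p) : ∃ ρ : θ ⟶ ζ, ρ ▷ p = τ := by
  have hf X := (hp X).1
  have hff X := (hp X).2
  have hs (X : C) (x : F.obj X) :
      ∃ r : (θ.app X).toFunctor.obj x ⟶ (ζ.app X).toFunctor.obj x,
        (p.app X).toFunctor.map r = modApp τ X x := (p.app X).toFunctor.map_surjective _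
  choose r hr using hs
  refine ⟨modMk r (fun X x y a => ?_) fun {X Y} f x => ?_, PseudoNat.mod_ext hr⟩
  · apply (p.app X).toFunctor.map_injective
    rw [Functor.map_comp, Functor.map_comp, hr, hr]
    exact modApp_naturality τ X a
  · apply (p.app Y).toFunctor.map_injective
    -- The cells of `θ ≫ p` and `ζ ≫ p` end in a cell of `p`. As that cell is invertible, it may be
    -- appended, and the goal becomes the modification axiom for `τ`.
    rw [← cancel_mono (cell p f _)]
    have h := modApp_cell τ f x
    rw [comp_cell, comp_cell] at h
    simp only [Functor.map_comp, Category.assoc, cell_naturality, hr]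
    exact (Category.assoc _ _ _).trans (h.trans (Category.assoc _ _ _))

theorem FullyFaithful.exists_lift_iso (hp : FullyFaithful p) {θ ζ : PseudoNat F G}
    (τ : (θ ≫ p : PseudoNat F H) ≅ ζ ≫ p) : ∃ ρ : θ ≅ ζ, ρ.hom ▷ p = τ.hom := by
  obtain ⟨ρ, hρ⟩ := hp.exists_lift τ.hom
  obtain ⟨ρ', hρ'⟩ := hp.exists_lift τ.inv
  exact ⟨⟨ρ, ρ', hp.mod_ext (by simp [hρ, hρ']), hp.mod_ext (by simp [hρ, hρ'])⟩, hρ⟩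

/-- A section of a fully faithful transformation is a pseudo-inverse. -/
theorem FullyFaithful.nonempty_iso_of_section {p : PseudoNat G F} (hp : FullyFaithful p)
    {s : PseudoNat F G} (h : (s ≫ p : PseudoNat F F) = 𝟙 F.toPseudofunctor) :
    Nonempty ((p ≫ s : PseudoNat G G) ≅ 𝟙 G.toPseudofunctor) := by
  -- After composition with `p` both sides become `p`, so the isomorphism lifts.
  obtain ⟨ρ, -⟩ := hp.exists_lift_iso (θ := p ≫ s) (ζ := 𝟙 G.toPseudofunctor)
    (α_ p s p ≪≫ whiskerLeftIso p (eqToIso h) ≪≫ ρ_ p ≪≫ (λ_ p).symm)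
  exact ⟨ρ⟩

/-! ### Equality of pseudonatural transformations -/

/-- When the components are equalities, the naturality squares are exactly the conjugation formula
that equality of functors requires on morphisms. -/
theorem functor_eq_of_natTrans {X : Type u₁} [Category.{v₁} X] {Y : Type u₂} [Category.{v₂} Y]
    {F G : X ⥤ Y} (α : F ⟶ G) (h : ∀ x, IsEqToHom (α.app x)) : IsEqToHom α := by
  have e : F = G := CategoryTheory.Functor.ext (fun x => (h x).1) fun x y a => by
    have := α.naturality a
    rw [(h x).2, (h y).2, comp_eqToHom_iff] at this
    simpa using this
  subst e
  refine ⟨rfl, ?_⟩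
  ext x
  rw [(h x).2]
  simp

/-- Replaces heterogeneous equality of structural cells: the modification axiom carries one family
of cells to the other along the equalities of components. -/
theorem eq_of_mod {θ ζ : PseudoNat F G} (ρ : θ ⟶ ζ)
    (h : ∀ X x, IsEqToHom (modApp ρ X x)) : θ = ζ := by
  have key : ∀ X, ∃ e : θ.app X = ζ.app X, ρ.as.app X = eqToHom e := fun X => by
    obtain ⟨e, he⟩ := functor_eq_of_natTrans (ρ.as.app X).toNatTrans (h X)
    refine ⟨Cat.Hom.ext e, Cat.Hom₂.ext ?_⟩
    rw [he, Cat.Hom₂.eqToHom_toNatTrans]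
  have nat := fun {X Y : C} (f : X ⟶ Y) => ρ.as.naturality f
  -- The components must be free variables before they can be replaced by identities.
  generalize ρ.as.app = r at key nat
  obtain ⟨θa, θn, h1, h2, h3⟩ := θ
  obtain ⟨ζa, ζn, k1, k2, k3⟩ := ζ
  obtain rfl : θa = ζa := funext fun X => (key X).1
  obtain rfl : r = fun X => 𝟙 _ := funext fun X => (key X).2
  have : @θn = @ζn := by
    funext X Y f
    apply Iso.ext
    simpa using (nat f).symm
  subst this
  rfl

end PseudoNat

end Modifications

section Strictify

open scoped Pseudofunctor.StrongTrans

/-! ### Isomorphisms of categories -/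

/-- The inverse acts on morphisms by preimages, conjugated by the equalities of objects;
faithfulness gives the functor laws. -/
theorem IsIsoOfCategories.of_bijective {X : Type u₁} [Category.{v₁} X] {Y : Type u₂}
    [Category.{v₂} Y] (Φ : X ⥤ Y) [Φ.Full] [Φ.Faithful] (h : Function.Bijective Φ.obj) :
    IsIsoOfCategories Φ := by
  obtain ⟨σ, hl, hr⟩ := Function.bijective_iff_has_inverse.mp h
  let Ψ : Y ⥤ X :=
    { obj := σ
      map := fun {y y'} g => Φ.preimage (eqToHom (hr y) ≫ g ≫ eqToHom (hr y').symm)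
      map_id := fun y => Φ.map_injective (by simp)
      map_comp := fun a b => Φ.map_injective (by simp) }
  refine ⟨Ψ, CategoryTheory.Functor.ext hl fun x x' a => Φ.map_injective ?_,
    CategoryTheory.Functor.ext hr fun y y' a => ?_⟩
  · simp [Ψ, eqToHom_map]
  · simp [Ψ]

/-- Precomposition with `g` is a quasi-inverse. No triangle identity between `i` and `j` is needed.
-/
theorem isEquivalence_precomp {B : Type u₁} [Bicategory.{w₁, v₁} B] {a b : B} (c : B)
    {f : a ⟶ b} {g : b ⟶ a} (i : f ≫ g ≅ 𝟙 a) (j : g ≫ f ≅ 𝟙 b) :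
    (Bicategory.precomp c f).IsEquivalence :=
  Functor.IsEquivalence.mk' (Bicategory.precomp c g)
    (NatIso.ofComponents (fun h => (λ_ h).symm ≪≫ whiskerRightIso j.symm h ≪≫ α_ g f h)
      (fun {h k} ρ => by
        change ρ ≫ (λ_ k).inv ≫ j.inv ▷ k ≫ (α_ g f k).hom =
          ((λ_ h).inv ≫ j.inv ▷ h ≫ (α_ g f h).hom) ≫ g ◁ f ◁ ρ
        rw [leftUnitor_inv_naturality_assoc, whisker_exchange_assoc]
        simp))
    (NatIso.ofComponents (fun h => (α_ f g h).symm ≪≫ whiskerRightIso i h ≪≫ λ_ h)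
      (fun {h k} ρ => by
        change f ◁ g ◁ ρ ≫ (α_ f g k).inv ≫ i.hom ▷ k ≫ (λ_ k).hom =
          ((α_ f g h).inv ≫ i.hom ▷ h ≫ (λ_ h).hom) ≫ ρ
        simp only [Category.assoc, ← leftUnitor_naturality, ← whisker_exchange_assoc]
        simp))

variable {C : Type u₁} [Bicategory.{w₁, v₁} C]

/-! ### 2-natural transformations as pseudonatural ones with trivial cells -/

namespace TwoNat

variable {F G : TwoFunctor C Cat.{w₂, u₂}}

theorem cell_eq (θ : TwoNat F G) {X Y : C} (f : X ⟶ Y) (x : F.obj X) :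
    PseudoNat.cell θ.toPseudoNat f x =
      eqToHom (congrArg (fun k => k.toFunctor.obj x) (θ.comm f)) := by
  change (θ.toPseudoNat.naturality f).hom.toNatTrans.app x = _
  rw [θ.naturality_eq]
  exact cat_eqToHom_app (θ.comm f) x

theorem isEqToHom_cell (θ : TwoNat F G) {X Y : C} (f : X ⟶ Y) (x : F.obj X) :
    IsEqToHom (PseudoNat.cell θ.toPseudoNat f x) :=
  ⟨_, θ.cell_eq f x⟩

end TwoNat

namespace PseudoNat

variable {F G : TwoFunctor C Cat.{w₂, u₂}}

theorem modApp_eqToHom {θ ζ : PseudoNat F G} (h : θ = ζ) (X : C) (x : F.obj X) :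
    IsEqToHom (modApp (eqToHom h) X x) := by
  subst h
  exact ⟨rfl, rfl⟩

theorem cell_congr (θ : PseudoNat F G) {X Y : C} {f g : X ⟶ Y} (h : f = g) (x : F.obj X) :
    cell θ f x = eqToHom (by rw [h]) ≫ cell θ g x ≫ eqToHom (by rw [h]) := by
  subst h; simp

end PseudoNat

end Strictify

/-! ### The left adjoint of the inclusion `Hom(C, Cat) → Hom_p(C, Cat)` -/

section LeftAdjoint

open scoped Pseudofunctor.StrongTrans

variable {C : Type u} [Bicategory.{v, v} C] [Strict C]

omit [Strict C] in
theorem ObjectsOver.isEqToHom_hom {L : TwoFunctor C Cat.{w₂, u₂}} (T : ObjectsOver L) {X : C}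
    {s t : T.Fiber X} {a : s ⟶ t} (ha : IsEqToHom a) : IsEqToHom a.hom := by
  obtain ⟨rfl, rfl⟩ := ha
  exact ⟨rfl, rfl⟩

/-- The objects of `F' X`: an arrow `A ⟶ X` and an object of `F A`. -/
def freeObjects (F : TwoFunctor C Cat.{v, max v u}) : ObjectsOver F where
  carrier X := Σ A : C, (A ⟶ X) × F.obj A
  act h t := ⟨t.1, t.2.1 ≫ h, t.2.2⟩
  act_id X t := by rw [Strict.comp_id]
  act_comp f g t := by rw [Strict.assoc]
  proj t := (F.map t.2.1).toFunctor.obj t.2.2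
  proj_act f t := CatValued.map_comp_obj F t.2.1 f t.2.2

variable (F : TwoFunctor C Cat.{v, max v u})

/-- The value at `F` of the left adjoint of the inclusion `Hom(C, Cat) → Hom_p(C, Cat)`. -/
abbrev strictify : TwoFunctor C Cat.{v, max v u} := (freeObjects F).fullImage

/-- The counit of the adjunction. -/
abbrev counit : strictify F ⟶ F := (freeObjects F).incl

theorem ObjectsOver.incl_fullyFaithful {L : TwoFunctor C Cat.{w₂, u₂}} (T : ObjectsOver L) :
    PseudoNat.FullyFaithful T.incl.toPseudoNat := fun X =>
  ⟨inferInstanceAs (inducedFunctor (T.proj (X := X))).Full,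
    inferInstanceAs (inducedFunctor (T.proj (X := X))).Faithful⟩

/-- The component at `X` of the unit. -/
def unitApp (X : C) : F.obj X ⥤ (freeObjects F).Fiber X where
  obj x := ⟨X, 𝟙 X, x⟩
  map a := InducedCategory.homMk ((F.map (𝟙 X)).toFunctor.map a)
  map_id _ := (freeObjects F).fiber_hom_ext (by simp; rfl)
  map_comp _ _ := (freeObjects F).fiber_hom_ext (by simp; rfl)

theorem map_id_map_obj {X Y : C} (f : X ⟶ Y) (x : F.obj X) :
    (F.map (𝟙 Y)).toFunctor.obj ((F.map f).toFunctor.obj x) =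
      (F.map (𝟙 X ≫ f)).toFunctor.obj x := by
  rw [CatValued.map_id_obj, Strict.id_comp]

/-- The structural isomorphism of the unit at `f` and `x`. -/
def unitCell {X Y : C} (f : X ⟶ Y) (x : F.obj X) :
    (unitApp F Y).obj ((F.map f).toFunctor.obj x) ≅
      ((freeObjects F).fiberMap f).obj ((unitApp F X).obj x) :=
  InducedCategory.isoMk (eqToIso (map_id_map_obj F f x))

/-- The unit of the adjunction. -/
def unit : PseudoNat F (strictify F) :=
  PseudoNat.mk' (fun X => (unitApp F X).toCatHom) (fun f x => unitCell F f x)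
    (fun {X Y} f x y a => (freeObjects F).fiber_hom_ext (by
      change (F.map (𝟙 Y)).toFunctor.map ((F.map f).toFunctor.map a) ≫
          eqToHom (map_id_map_obj F f y) = eqToHom (map_id_map_obj F f x) ≫
        eqToHom (CatValued.map_comp_obj F _ _ _) ≫
          (F.map f).toFunctor.map ((F.map (𝟙 X)).toFunctor.map a) ≫
            eqToHom (CatValued.map_comp_obj F _ _ _).symm
      simp [CatValued.map_id_map, eqToHom_map]))
    (fun {X Y} f g α x => (freeObjects F).fiber_hom_ext (by
      change (F.map (𝟙 Y)).toFunctor.map ((F.map₂ α).toNatTrans.app x) ≫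
          eqToHom (map_id_map_obj F g x) = eqToHom (map_id_map_obj F f x) ≫
        eqToHom (CatValued.map_comp_obj F _ _ _) ≫
          (F.map₂ α).toNatTrans.app ((F.map (𝟙 X)).toFunctor.obj x) ≫
            eqToHom (CatValued.map_comp_obj F _ _ _).symm
      simp [CatValued.map_id_map, natTrans_app_congr (F.map₂ α) (CatValued.map_id_obj F X x)]))
    (fun X x => (freeObjects F).fiber_hom_ext (by
      refine Eq.trans ?_ ((freeObjects F).eqToHom_hom _).symm
      rfl))
    (fun {X Y Z} f g x => (freeObjects F).fiber_hom_ext (by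
      refine IsEqToHom.eq (.eqToHom (map_id_map_obj F (f ≫ g) x))
        (.comp ((freeObjects F).isEqToHom_hom (.eqToHom _))
          (.comp (.eqToHom (map_id_map_obj F g _))
            (.comp ?_ ((freeObjects F).isEqToHom_hom (.eqToHom _)))))
      exact .comp (.eqToHom (CatValued.map_comp_obj F _ _ _))
        (.comp (.map _ (.eqToHom (map_id_map_obj F f x)))
          (.eqToHom (CatValued.map_comp_obj F _ _ _).symm))))

/-- On objects the composite is `x ↦ F(𝟙) x`, equal to `x` by strictness; all cells involved are
equalities. -/
theorem unit_comp_counit :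
    (unit F ≫ (counit F).toPseudoNat : PseudoNat F F) = 𝟙 F.toPseudofunctor := by
  refine PseudoNat.eq_of_mod (PseudoNat.modMk
    (fun X x => eqToHom (CatValued.map_id_obj F X x)) (fun X x y a => ?_)
    (fun {X Y} f x => ?_)) fun X x => .eqToHom (CatValued.map_id_obj F X x)
  · change (F.map (𝟙 X)).toFunctor.map a ≫ eqToHom (CatValued.map_id_obj F X y) =
      eqToHom (CatValued.map_id_obj F X x) ≫ a
    simp [CatValued.map_id_map]
  · refine IsEqToHom.eq (.comp (.eqToHom _) ((TwoNat.id F).isEqToHom_cell f x)) ?_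
    refine .comp ?_ (.map _ (.eqToHom _))
    rw [PseudoNat.comp_cell]
    exact .comp (.eqToHom (map_id_map_obj F f x)) ((counit F).isEqToHom_cell _ _)

theorem nonempty_counit_comp_unit : Nonempty (((counit F).toPseudoNat ≫ unit F :
    PseudoNat (strictify F) (strictify F)) ≅ 𝟙 (strictify F).toPseudofunctor) :=
  (freeObjects F).incl_fullyFaithful.nonempty_iso_of_section (unit_comp_counit F)

variable {F} {G : TwoFunctor C Cat.{v, max v u}}

instance incl_full : (TwoNat.incl F G).Full := ⟨fun ρ => ⟨⟨ρ⟩, rfl⟩⟩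

instance incl_faithful : (TwoNat.incl F G).Faithful := ⟨fun h => TwoNat.Hom.ext h⟩

instance precomp_unit_isEquivalence :
    (Bicategory.precomp G.toPseudofunctor (unit F)).IsEquivalence :=
  isEquivalence_precomp _ (eqToIso (unit_comp_counit F)) (nonempty_counit_comp_unit F).some

instance precompPseudo_full : (precompPseudo (unit F) G).Full :=
  inferInstanceAs (TwoNat.incl (strictify F) G ⋙ Bicategory.precomp G.toPseudofunctor (unit F)).Full

instance precompPseudo_faithful : (precompPseudo (unit F) G).Faithful :=
  inferInstanceAs
    (TwoNat.incl (strictify F) G ⋙ Bicategory.precomp G.toPseudofunctor (unit F)).Faithful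

/-- A 2-natural transformation out of `strictify F` is determined by its restriction along the unit,
since the objects `(A, 𝟙 A, x)` generate the others under the action of `C`. Fullness of
precomposition turns the equality of restrictions into a modification `ρ`, whose components are then
shown to be equalities. -/
theorem precompPseudo_injective : Function.Injective (precompPseudo (unit F) G).obj := by
  intro θ ζ h
  have h' : (unit F ≫ θ.toPseudoNat : PseudoNat F G) = unit F ≫ ζ.toPseudoNat := h
  obtain ⟨ρ, hρ⟩ :=
    (Bicategory.precomp G.toPseudofunctor (unit F)).map_surjective (eqToHom h')
  have h0 (X : C) (x : F.obj X) : IsEqToHom (PseudoNat.modApp ρ X ⟨X, 𝟙 X, x⟩) := by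
    have := PseudoNat.modApp_eqToHom h' X x
    exact .congr (congrArg (fun t => PseudoNat.modApp t X x) hρ) this
  refine TwoNat.ext_app fun X => congrFun (congrArg Pseudofunctor.StrongTrans.app
    (PseudoNat.eq_of_mod ρ fun X t => ?_)) X
  obtain ⟨A, f, x⟩ := t
  -- In the square of `ρ` at `f` both structural cells are equalities, so the property spreads from
  -- the generator to its image under `f`.
  have h1 : IsEqToHom (PseudoNat.modApp ρ X ((((strictify F).map f).toFunctor.obj ⟨A, 𝟙 A, x⟩))) :=
    IsEqToHom.of_comp (ζ.isEqToHom_cell f _) (.congr (PseudoNat.modApp_cell ρ f _)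
      (.comp (θ.isEqToHom_cell f _) (.map _ (h0 A x))))
  have e : ((strictify F).map f).toFunctor.obj (⟨A, 𝟙 A, x⟩ : (freeObjects F).Fiber A) =
      (⟨A, f, x⟩ : (freeObjects F).Fiber X) := by
    change (⟨A, 𝟙 A ≫ f, x⟩ : (freeObjects F).carrier X) = ⟨A, f, x⟩
    rw [Strict.id_comp]
  rw [e] at h1
  exact h1

/-- The values of the 2-natural transformation corresponding to `θ`. -/
def strictExtendObj (θ : PseudoNat F G) {X : C} (t : (freeObjects F).carrier X) : G.obj X :=
  (G.map t.2.1).toFunctor.obj ((θ.app t.1).toFunctor.obj t.2.2)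

theorem strictExtendObj_act (θ : PseudoNat F G) {X Y : C} (h : X ⟶ Y)
    (t : (freeObjects F).carrier X) : strictExtendObj θ ((freeObjects F).act h t) =
      (G.map h).toFunctor.obj (strictExtendObj θ t) :=
  CatValued.map_comp_obj G t.2.1 h _

/-- The comparison of a pseudonatural transformation with its strict extension. -/
def strictExtendCell (θ : PseudoNat F G) {X : C} (t : (freeObjects F).carrier X) :
    (θ.app X).toFunctor.obj ((freeObjects F).proj t) ≅ strictExtendObj θ t :=
  PseudoNat.cellIso θ t.2.1 t.2.2

/-- This is the composition axiom for the cells of `θ`; it is what makes the extension strictly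
compatible with arrows of `C`. -/
theorem strictExtendCell_act (θ : PseudoNat F G) {X Y : C} (h : X ⟶ Y)
    (t : (freeObjects F).carrier X) :
    (strictExtendCell θ ((freeObjects F).act h t)).hom =
      eqToHom (congrArg (θ.app Y).toFunctor.obj ((freeObjects F).proj_act h t)) ≫
        PseudoNat.cell θ h ((freeObjects F).proj t) ≫
          (G.map h).toFunctor.map (strictExtendCell θ t).hom ≫
            eqToHom (strictExtendObj_act θ h t).symm :=
  PseudoNat.cell_comp θ t.2.1 h t.2.2

/-- The extension acts on morphisms by conjugating `θ` with its own cells. Naturality of the cell at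
`h` moves the action of `h` through, and the cells at `s` cancel. -/
theorem strictExtend_map (θ : PseudoNat F G) {X Y : C} (h : X ⟶ Y)
    {s t : (freeObjects F).carrier X} (a : (freeObjects F).proj s ⟶ (freeObjects F).proj t) :
    (strictExtendCell θ ((freeObjects F).act h s)).inv ≫
        (θ.app Y).toFunctor.map (eqToHom ((freeObjects F).proj_act h s) ≫
          (F.map h).toFunctor.map a ≫ eqToHom ((freeObjects F).proj_act h t).symm) ≫
        (strictExtendCell θ ((freeObjects F).act h t)).hom =
      eqToHom (strictExtendObj_act θ h s) ≫
        (G.map h).toFunctor.map ((strictExtendCell θ s).inv ≫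
          (θ.app X).toFunctor.map a ≫ (strictExtendCell θ t).hom) ≫
        eqToHom (strictExtendObj_act θ h t).symm := by
  rw [Iso.inv_comp_eq, strictExtendCell_act, strictExtendCell_act]
  have e : (G.map h).toFunctor.map (strictExtendCell θ s).hom ≫
      (G.map h).toFunctor.map (strictExtendCell θ s).inv = 𝟙 _ := by
    rw [← Functor.map_comp, Iso.hom_inv_id, CategoryTheory.Functor.map_id]
  simp [eqToHom_map, PseudoNat.cell_naturality_assoc, reassoc_of% e]

theorem strictExtend_map₂ (θ : PseudoNat F G) {X Y : C} {h k : X ⟶ Y} (α : h ⟶ k)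
    (t : (freeObjects F).carrier X) :
    (strictExtendCell θ ((freeObjects F).act h t)).inv ≫
        (θ.app Y).toFunctor.map (eqToHom ((freeObjects F).proj_act h t) ≫
          (F.map₂ α).toNatTrans.app ((freeObjects F).proj t) ≫
            eqToHom ((freeObjects F).proj_act k t).symm) ≫
        (strictExtendCell θ ((freeObjects F).act k t)).hom =
      eqToHom (strictExtendObj_act θ h t) ≫ (G.map₂ α).toNatTrans.app (strictExtendObj θ t) ≫
        eqToHom (strictExtendObj_act θ k t).symm := by
  rw [Iso.inv_comp_eq, strictExtendCell_act, strictExtendCell_act]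
  simp [eqToHom_map, PseudoNat.cell_map₂_assoc]

/-- The component at `X` of the 2-natural transformation corresponding to a pseudonatural one. -/
def strictExtendApp (θ : PseudoNat F G) (X : C) : (freeObjects F).Fiber X ⥤ G.obj X where
  obj t := strictExtendObj θ t
  map {s t} a := (strictExtendCell θ s).inv ≫ (θ.app X).toFunctor.map a.hom ≫
    (strictExtendCell θ t).hom
  map_id t := by
    rw [Iso.inv_comp_eq, Category.comp_id]
    exact (congrArg (· ≫ _) ((θ.app X).toFunctor.map_id _)).trans (Category.id_comp _)
  map_comp a b := by simp

/-- The 2-natural transformation corresponding to a pseudonatural one. -/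
def strictExtend (θ : PseudoNat F G) : strictify F ⟶ G :=
  TwoNat.mk' (fun X => (strictExtendApp θ X).toCatHom)
    (fun h => Cat.Hom.ext (CategoryTheory.Functor.ext (fun t => strictExtendObj_act θ h t)
      fun _ _ a => strictExtend_map θ h a.hom))
    (fun α => cat_square _ _ _ _ fun t => strictExtend_map₂ θ α t)

/-- On `(X, 𝟙 X, x)` the conjugating cell is that of `θ` at an identity, hence an equality. What
remains of the cell at `f` is the cell of `θ` itself. -/
theorem unit_strictExtend (θ : PseudoNat F G) :
    (unit F ≫ (strictExtend θ).toPseudoNat : PseudoNat F G) = θ := by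
  refine PseudoNat.eq_of_mod (PseudoNat.modMk
    (fun X x => eqToHom (CatValued.map_id_obj G X _)) (fun X x y a => ?_)
    (fun {X Y} f x => ?_)) fun X x => .eqToHom (CatValued.map_id_obj G X _)
  · change ((PseudoNat.cellIso θ (𝟙 X) x).inv ≫ (θ.app X).toFunctor.map
        ((F.map (𝟙 X)).toFunctor.map a) ≫ PseudoNat.cell θ (𝟙 X) y) ≫
        eqToHom (CatValued.map_id_obj G X _) =
      eqToHom (CatValued.map_id_obj G X _) ≫ (θ.app X).toFunctor.map a
    rw [PseudoNat.cell_naturality]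
    simp [CatValued.map_id_map]
  · rw [PseudoNat.comp_cell, TwoNat.cell_eq]
    change eqToHom (CatValued.map_id_obj G Y _) ≫ PseudoNat.cell θ f x =
      (((PseudoNat.cellIso θ (𝟙 Y) ((F.map f).toFunctor.obj x)).inv ≫
      (θ.app Y).toFunctor.map (eqToHom (map_id_map_obj F f x)) ≫
        PseudoNat.cell θ (𝟙 X ≫ f) x) ≫ eqToHom (CatValued.map_comp_obj G (𝟙 X) f _)) ≫
        (G.map f).toFunctor.map (eqToHom (CatValued.map_id_obj G X _))
    have e : (PseudoNat.cellIso θ (𝟙 Y) ((F.map f).toFunctor.obj x)).inv = eqToHom (by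
        rw [CatValued.map_id_obj, CatValued.map_id_obj]) := by
      rw [← cancel_epi (PseudoNat.cellIso θ (𝟙 Y) ((F.map f).toFunctor.obj x)).hom,
        Iso.hom_inv_id]
      simp [PseudoNat.cell_id]
    rw [PseudoNat.cell_congr θ (Strict.id_comp f), e]
    simp [eqToHom_map]

theorem isLeftAdjointValue_unit : IsLeftAdjointValue (unit F) := fun _ =>
  .of_bijective _ ⟨precompPseudo_injective, fun θ => ⟨strictExtend θ, unit_strictExtend θ⟩⟩

end LeftAdjoint

/-! ### Strict lifts of 2-natural transformations to full images -/

section Lift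

variable {C : Type u₁} [Bicategory.{w₁, v₁} C] [Strict C] {G L : TwoFunctor C Cat.{w₂, u₂}}

namespace TwoNat

theorem app_map_obj (θ : G ⟶ L) {X Y : C} (f : X ⟶ Y) (x : G.obj X) :
    (θ.toPseudoNat.app Y).toFunctor.obj ((G.map f).toFunctor.obj x) =
      (L.map f).toFunctor.obj ((θ.toPseudoNat.app X).toFunctor.obj x) :=
  congrArg (fun k => k.toFunctor.obj x) (θ.comm f)

theorem app_map_map (θ : G ⟶ L) {X Y : C} (f : X ⟶ Y) {x y : G.obj X} (a : x ⟶ y) :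
    (θ.toPseudoNat.app Y).toFunctor.map ((G.map f).toFunctor.map a) =
      eqToHom (app_map_obj θ f x) ≫
        (L.map f).toFunctor.map ((θ.toPseudoNat.app X).toFunctor.map a) ≫
          eqToHom (app_map_obj θ f y).symm :=
  CatValued.map_congr (θ.comm f) a

theorem app_map₂_app (θ : G ⟶ L) {X Y : C} {f g : X ⟶ Y} (α : f ⟶ g) (x : G.obj X) :
    (θ.toPseudoNat.app Y).toFunctor.map ((G.map₂ α).toNatTrans.app x) =
      eqToHom (app_map_obj θ f x) ≫
        (L.map₂ α).toNatTrans.app ((θ.toPseudoNat.app X).toFunctor.obj x) ≫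
          eqToHom (app_map_obj θ g x).symm := by
  have h := PseudoNat.cell_map₂ θ.toPseudoNat α x
  rw [θ.cell_eq, θ.cell_eq, comp_eqToHom_iff] at h
  simpa using h

end TwoNat

namespace ObjectsOver

variable (T : ObjectsOver L) (θ : G ⟶ L) (m : ∀ {X : C}, G.obj X → T.carrier X)
  (hm : ∀ {X : C} (x : G.obj X), T.proj (m x) = (θ.toPseudoNat.app X).toFunctor.obj x)

/-- The component at `X` of the lift of a 2-natural transformation to a full image. -/
def liftApp (X : C) : G.obj X ⥤ T.Fiber X where
  obj x := m x
  map {x y} a := InducedCategory.homMk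
    (eqToHom (hm x) ≫ (θ.toPseudoNat.app X).toFunctor.map a ≫ eqToHom (hm y).symm)
  map_id x := T.fiber_hom_ext (by simp)
  map_comp a b := T.fiber_hom_ext (by simp)

/-- The lift of a 2-natural transformation to a full image, given by a lift on objects. -/
def lift (hact : ∀ {X Y : C} (f : X ⟶ Y) (x : G.obj X),
    m ((G.map f).toFunctor.obj x) = T.act f (m x)) : G ⟶ T.fullImage :=
  TwoNat.mk' (fun X => (T.liftApp θ m hm X).toCatHom)
    (fun {X Y} f => Cat.Hom.ext (CategoryTheory.Functor.ext (fun x => hact f x)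
      fun x y a => T.fiber_hom_ext (by
        refine Eq.trans ?_ (T.conj_hom (hact f x)
          ((T.fiberMap f).map ((T.liftApp θ m hm X).map a)) (hact f y).symm).symm
        change eqToHom (hm _) ≫
            (θ.toPseudoNat.app Y).toFunctor.map ((G.map f).toFunctor.map a) ≫
              eqToHom (hm _).symm =
          eqToHom (congrArg T.proj (hact f x)) ≫ (eqToHom (T.proj_act f (m x)) ≫
            (L.map f).toFunctor.map (eqToHom (hm x) ≫
              (θ.toPseudoNat.app X).toFunctor.map a ≫ eqToHom (hm y).symm) ≫
                eqToHom (T.proj_act f (m y)).symm) ≫ eqToHom (congrArg T.proj (hact f y).symm)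
        rw [TwoNat.app_map_map]
        simp [eqToHom_map])))
    (fun {X Y f g} α => cat_square _ _ _ _ fun x => T.fiber_hom_ext (by
      refine Eq.trans ?_ (T.conj_hom (hact f x) ((T.fiberMap₂ α).app (m x)) (hact g x).symm).symm
      change eqToHom (hm _) ≫
          (θ.toPseudoNat.app Y).toFunctor.map ((G.map₂ α).toNatTrans.app x) ≫
            eqToHom (hm _).symm =
        eqToHom (congrArg T.proj (hact f x)) ≫ (eqToHom (T.proj_act f (m x)) ≫
          (L.map₂ α).toNatTrans.app (T.proj (m x)) ≫
            eqToHom (T.proj_act g (m x)).symm) ≫ eqToHom (congrArg T.proj (hact g x).symm)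
      rw [TwoNat.app_map₂_app, natTrans_app_congr (L.map₂ α) (hm x)]
      simp))

theorem lift_incl (hact : ∀ {X Y : C} (f : X ⟶ Y) (x : G.obj X),
    m ((G.map f).toFunctor.obj x) = T.act f (m x)) : T.lift θ m hm hact ≫ T.incl = θ :=
  TwoNat.ext_app fun _ => Cat.Hom.ext (CategoryTheory.Functor.ext (fun x => hm x)
    fun _ _ _ => rfl)

end ObjectsOver

end Lift

/-! ### Pseudocones -/

namespace Pseudocone

variable {I : Type u₁} [Bicategory.{w₁, v₁} I] {A : Type u₂} [Bicategory.{w₂, v₂} A]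
  {F : TwoFunctor I A}

/-- The analogue of `PseudoNat.eq_of_mod` for pseudocones. -/
theorem eq_of_hom {X : A} {θ η : Pseudocone F X} (ρ : θ ⟶ η) (h : ∀ i, IsEqToHom (ρ.app i)) :
    θ = η := by
  have nat := fun {i j : I} (f : i ⟶ j) => ρ.naturality f
  generalize Hom.app ρ = r at h nat
  obtain ⟨θl, θc, h1, h2, h3⟩ := θ
  obtain ⟨ηl, ηc, k1, k2, k3⟩ := η
  obtain rfl : θl = ηl := funext fun i => (h i).1
  obtain rfl : r = fun i => 𝟙 _ := funext fun i => (h i).2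
  have : @θc = @ηc := by
    funext i j f
    apply Iso.ext
    simpa using (nat f).symm
  subst this
  rfl

variable {P L : A} {p : P ⟶ L}

/-- Pseudocones lift along fully faithful arrows. -/
theorem exists_lift (lam : Pseudocone F L) (q : ∀ i, F.obj i ⟶ P) (w : ∀ i, q i ≫ p ≅ lam.leg i)
    (hw : ∀ i, IsEqToHom (w i).hom)
    (hf : ∀ {X : A} (f g : X ⟶ P) (τ : f ≫ p ≅ g ≫ p), ∃ ρ : f ≅ g, ρ.hom ▷ p = τ.hom)
    (hi : ∀ {X : A} {f g : X ⟶ P} (ρ τ : f ⟶ g), ρ ▷ p = τ ▷ p → ρ = τ) :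
    ∃ (Q : Pseudocone F P) (e : ∀ i, Q.leg i ≫ p ≅ lam.leg i),
      (∀ i, IsEqToHom (e i).hom) ∧
      ∀ {i j : I} (f : i ⟶ j), (Q.cell f).hom ▷ p = (e i).hom ≫ (lam.cell f).hom ≫
        F.map f ◁ (e j).inv ≫ (α_ _ _ _).inv := by
  -- The lifted cells are those of `lam`, transported along the identifications `w`.
  choose c hc using fun {i j : I} (f : i ⟶ j) => hf (q i) (F.map f ≫ q j)
    (w i ≪≫ lam.cell f ≪≫ whiskerLeftIso (F.map f) (w j).symm ≪≫ (α_ _ _ _).symm)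
  refine ⟨⟨q, c, fun i => hi _ _ ?_, fun {i j k} f g => hi _ _ ?_, fun {i j f g} α => hi _ _ ?_⟩,
    w, hw, hc⟩
  -- By faithfulness the three axioms are checked after whiskering with `p`, where they reduce to
  -- those of `lam`.
  · simp [hc, lam.cell_id]
    rw [← whisker_exchange_assoc]
    simp
  · simp [hc, lam.cell_comp]
    rw [← whisker_exchange_assoc]
    simp
  · simp [hc, lam.cell_naturality α]
    rw [← whisker_exchange_assoc]
    simp

/-- Restricted along `lam`, both `t ≫ p` and `𝟙 L` give `lam` up to equalities of 1-cells: for the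
first, because `Q` lies over `lam`. The universal property makes restriction injective on 1-cells,
so the two agree on the nose. -/
theorem comp_eq_id [Strict A] {lam : Pseudocone F L} (hlam : lam.IsPseudocolimit) {t : L ⟶ P}
    {Q : Pseudocone F P} (ht : (lam.extend P).obj t = Q) (e : ∀ i, Q.leg i ≫ p ≅ lam.leg i)
    (he : ∀ i, IsEqToHom (e i).hom)
    (hQ : ∀ {i j : I} (f : i ⟶ j), (Q.cell f).hom ▷ p = (e i).hom ≫ (lam.cell f).hom ≫
        F.map f ◁ (e j).inv ≫ (α_ _ _ _).inv) : t ≫ p = 𝟙 L := by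
  obtain ⟨Ψ, h, -⟩ := hlam L
  have inj : Function.Injective (lam.extend L).obj := fun f g hfg => by
    have := congrArg Ψ.obj hfg
    change (lam.extend L ⋙ Ψ).obj f = (lam.extend L ⋙ Ψ).obj g at this
    rwa [h] at this
  subst ht
  change ∀ i, (lam.leg i ≫ t) ≫ p ≅ lam.leg i at e
  apply inj
  -- In a strict 2-category the associator and unitor are equalities, so every component of `ρ` is
  -- one and `eq_of_hom` applies.
  let ρ : (lam.extend L).obj (t ≫ p) ⟶ (lam.extend L).obj (𝟙 L) := Pseudocone.Hom.mk
    (fun i => (α_ (lam.leg i) t p).inv ≫ (e i).hom ≫ (ρ_ (lam.leg i)).inv)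
    (fun {i j} f => by
      have := hQ f
      simp [extend] at this ⊢
      simp [reassoc_of% this])
  exact eq_of_hom ρ fun i => .comp (z := lam.leg i ≫ 𝟙 L)
    (by rw [Strict.associator_eqToIso]; exact .eqToHom (Strict.assoc _ _ _).symm)
    (.comp (he i) (by rw [Strict.rightUnitor_eqToIso]; exact .eqToHom (Strict.comp_id _).symm))

end Pseudocone

section Main

variable {C : Type u} [Bicategory.{v, v} C] [Strict C]

open scoped Pseudofunctor.StrongTrans

/-! ### Extending the universe of objects -/

-- Morphisms in the lifted category are those of `X`, but the equality morphisms are formed from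
-- different equalities; the two conjugations agree.
attribute [local instance] uliftCategory in
theorem liftCat_conj {X : Cat.{v, v}} {x x' y y' : X} (h : x = x') (a : x' ⟶ y') (h' : y' = y) :
    eqToHom h ≫ a ≫ eqToHom h' =
      (eqToHom (congrArg ULift.up h) ≫
        (show (ULift.up.{u} x' : ULift X) ⟶ ULift.up y' from a) ≫
          eqToHom (congrArg ULift.up h') : (ULift.up.{u} x : ULift X) ⟶ ULift.up y) := by
  subst h h'
  refine (Category.id_comp _).trans ((Category.comp_id _).trans ?_)
  exact ((Category.id_comp _).trans (Category.comp_id _)).symm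

/-- The whiskering of a 2-natural transformation with the inclusion `liftCat`. -/
def liftNat {F G : TwoFunctor C Cat.{v, v}} (θ : F ⟶ G) :
    F.comp liftCat.{v, u} ⟶ G.comp liftCat.{v, u} :=
  TwoNat.mk' (fun X => liftCat.map (θ.toPseudoNat.app X))
    (fun f => congrArg liftCat.map (θ.comm f))
    (fun α => cat_square _ _ _ _ fun x =>
      (TwoNat.app_map₂_app θ α x.down).trans (liftCat_conj _ _ _))

theorem liftNat_comp {F G H : TwoFunctor C Cat.{v, v}} (θ : F ⟶ G) (ζ : G ⟶ H) :
    liftNat (θ ≫ ζ) = liftNat θ ≫ liftNat ζ :=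
  TwoNat.ext_app fun _ => rfl

theorem liftNat_id (F : TwoFunctor C Cat.{v, v}) : liftNat (𝟙 F) = 𝟙 (F.comp liftCat.{v, u}) :=
  TwoNat.ext_app fun _ => rfl

/-! ### Lifting along the counit -/

/-- A section of the counit exhibits a 2-functor as flexible. -/
theorem isFlexible_of_section {L : TwoFunctor C Cat.{v, v}}
    (s : L.comp liftCat.{v, u} ⟶ strictify (L.comp liftCat.{v, u}))
    (hs : s ≫ counit _ = 𝟙 (L.comp liftCat.{v, u})) : IsFlexible L := by
  refine ⟨strictify _, unit _, isLeftAdjointValue_unit, counit _, unit_comp_counit _, s, hs, ?_⟩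
  obtain ⟨i⟩ := (ObjectsOver.incl_fullyFaithful _).nonempty_iso_of_section
    (congrArg TwoNat.toPseudoNat hs)
  exact ⟨TwoNat.isoMk i⟩

/-- The 2-natural transformations from `F` to `L` lift along the counit at `L`. -/
def LiftsAlongCounit (F L : TwoFunctor C Cat.{v, v}) : Prop :=
  ∀ θ : F.comp liftCat.{v, u} ⟶ L.comp liftCat.{v, u},
    ∃ m : F.comp liftCat.{v, u} ⟶ strictify (L.comp liftCat.{v, u}), m ≫ counit _ = θ

-- Composition of pseudonatural transformations with values in `Cat` is strictly associative, as the
-- associator has identity components.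
omit [Strict C] in
theorem PseudoNat.assoc {F G H K : TwoFunctor C Cat.{w₂, u₂}} (θ : PseudoNat F G)
    (ζ : PseudoNat G H) (ξ : PseudoNat H K) :
    ((θ ≫ ζ : PseudoNat F H) ≫ ξ : PseudoNat F K) = θ ≫ (ζ ≫ ξ : PseudoNat G K) :=
  PseudoNat.eq_of_mod (α_ θ ζ ξ).hom fun _ _ => ⟨rfl, rfl⟩

omit [Strict C] in
theorem PseudoNat.id_comp {F G : TwoFunctor C Cat.{w₂, u₂}} (θ : PseudoNat F G) :
    (𝟙 F.toPseudofunctor ≫ θ : PseudoNat F G) = θ :=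
  PseudoNat.eq_of_mod (λ_ θ).hom fun _ _ => ⟨rfl, rfl⟩

omit [Strict C] in
theorem PseudoNat.comp_id {F G : TwoFunctor C Cat.{w₂, u₂}} (θ : PseudoNat F G) :
    (θ ≫ 𝟙 G.toPseudofunctor : PseudoNat F G) = θ :=
  PseudoNat.eq_of_mod (ρ_ θ).hom fun _ _ => ⟨rfl, rfl⟩

/-- The unit at `L` gives a pseudonatural lift of `θ`. Its transpose is a 2-natural transformation
out of `F'` lying over `e ≫ θ`, and precomposing with the section `s` removes `e`. -/
theorem IsFlexible.liftsAlongCounit {F : TwoFunctor C Cat.{v, v}} (hF : IsFlexible F)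
    (L : TwoFunctor C Cat.{v, v}) : LiftsAlongCounit F L := by
  intro θ
  obtain ⟨F', η, hη, e, he, s, hs, -⟩ := hF
  obtain ⟨Ψ, -, h⟩ := hη (strictify (L.comp liftCat.{v, u}))
  obtain ⟨Ψ', h', -⟩ := hη (L.comp liftCat.{v, u})
  let κ : PseudoNat (F.comp liftCat.{v, u}) (strictify (L.comp liftCat.{v, u})) :=
    θ.toPseudoNat ≫ unit _
  have hμ : (η ≫ (Ψ.obj κ).toPseudoNat : PseudoNat _ _) = κ :=
    congrArg (fun Φ => Φ.obj κ) h
  have inj (a b : F' ⟶ L.comp liftCat.{v, u})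
      (hab : (η ≫ a.toPseudoNat : PseudoNat _ _) = η ≫ b.toPseudoNat) : a = b := by
    have ha : Ψ'.obj (η ≫ a.toPseudoNat) = a := congrArg (fun Φ => Φ.obj a) h'
    have hb : Ψ'.obj (η ≫ b.toPseudoNat) = b := congrArg (fun Φ => Φ.obj b) h'
    rw [← ha, ← hb, hab]
  -- Transformations out of `F'` may be compared after `η`, where both sides become `θ` by the
  -- triangle identities.
  have key : Ψ.obj κ ≫ counit _ = e ≫ θ := by
    apply inj
    calc (η ≫ ((Ψ.obj κ).toPseudoNat ≫ (counit _).toPseudoNat) : PseudoNat _ _)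
        = (η ≫ (Ψ.obj κ).toPseudoNat : PseudoNat _ _) ≫ (counit _).toPseudoNat :=
          (PseudoNat.assoc _ _ _).symm
      _ = θ.toPseudoNat ≫ (unit _ ≫ (counit _).toPseudoNat) := by
          rw [hμ]; exact PseudoNat.assoc _ _ _
      _ = θ.toPseudoNat := by rw [unit_comp_counit]; exact PseudoNat.comp_id _
      _ = (η ≫ e.toPseudoNat : PseudoNat _ _) ≫ θ.toPseudoNat := by
          rw [he]; exact (PseudoNat.id_comp _).symm
      _ = η ≫ (e.toPseudoNat ≫ θ.toPseudoNat) := PseudoNat.assoc _ _ _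
  refine ⟨s ≫ Ψ.obj κ, ?_⟩
  rw [hom_assoc, key, ← hom_assoc, hs, hom_id_comp]

/-- Yoneda: `θ` is determined by its value `x` at `𝟙 X`, and `f ↦ (X, f, x)` is strictly compatible
with composition. -/
theorem liftsAlongCounit_rep (X : C) (L : TwoFunctor C Cat.{v, v}) :
    LiftsAlongCounit (rep X) L := by
  intro θ
  let x := (θ.toPseudoNat.app X).toFunctor.obj (ULift.up (𝟙 X))
  refine ⟨(freeObjects _).lift θ (fun f => ⟨X, f.down, x⟩) (fun {Y} f => ?_) (fun f g => rfl),
    ObjectsOver.lift_incl _ _ _ _ _⟩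
  refine (TwoNat.app_map_obj θ f.down (ULift.up (𝟙 X))).symm.trans ?_
  exact congrArg (θ.toPseudoNat.app Y).toFunctor.obj (congrArg ULift.up (Strict.id_comp f.down))

/-- The lifting property transfers along retracts, in particular along isomorphisms. -/
theorem IsRepresentable.liftsAlongCounit {F : TwoFunctor C Cat.{v, v}} (hF : IsRepresentable F)
    (L : TwoFunctor C Cat.{v, v}) : LiftsAlongCounit F L := by
  intro θ
  obtain ⟨X, φ, ψ, -, h⟩ := hF
  obtain ⟨m, hm⟩ := liftsAlongCounit_rep X L (liftNat φ ≫ θ)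
  refine ⟨liftNat ψ ≫ m, ?_⟩
  rw [hom_assoc, hm, ← hom_assoc, ← liftNat_comp, h, liftNat_id, hom_id_comp]

/-! ### Pseudocolimits -/

omit [Strict C] in
theorem hom_exists_lift_iso {F P L : TwoFunctor C Cat.{w₂, u₂}} {p : P ⟶ L}
    (hp : PseudoNat.FullyFaithful p.toPseudoNat) (θ ζ : F ⟶ P) (τ : θ ≫ p ≅ ζ ≫ p) :
    ∃ ρ : θ ≅ ζ, ρ.hom ▷ p = τ.hom := by
  obtain ⟨ρ, hρ⟩ := hp.exists_lift_iso (θ := θ.toPseudoNat) (ζ := ζ.toPseudoNat)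
    ((TwoNat.incl F L).mapIso τ)
  exact ⟨TwoNat.isoMk ρ, TwoNat.Hom.ext hρ⟩

omit [Strict C] in
theorem hom_whiskerRight_injective {F P L : TwoFunctor C Cat.{w₂, u₂}} {p : P ⟶ L}
    (hp : PseudoNat.FullyFaithful p.toPseudoNat) {θ ζ : F ⟶ P} (ρ τ : θ ⟶ ζ)
    (h : ρ ▷ p = τ ▷ p) : ρ = τ :=
  TwoNat.Hom.ext (hp.mod_ext (congrArg TwoNat.Hom.mod h))

variable {I : Type v} [Bicategory.{v, v} I] {F : TwoFunctor I (TwoFunctor C Cat.{v, v})}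
  {L : TwoFunctor C Cat.{v, v}}

/-- The objects of the 2-functors `F i`, over the vertex of a pseudocone. -/
def legObjects (lam : Pseudocone F L) : ObjectsOver L where
  carrier X := Σ i : I, (F.obj i).obj X
  act f t := ⟨t.1, ((F.obj t.1).map f).toFunctor.obj t.2⟩
  act_id X t := by rw [CatValued.map_id_obj]
  act_comp f g t := by rw [CatValued.map_comp_obj]
  proj {X} t := ((lam.leg t.1).toPseudoNat.app X).toFunctor.obj t.2
  proj_act f t := TwoNat.app_map_obj (lam.leg t.1) f t.2

/-- The vertex of a pseudocolimit is a retract of the full image of the legs. -/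
theorem exists_section_legObjects {lam : Pseudocone F L} (hlam : lam.IsPseudocolimit) :
    ∃ t : L ⟶ (legObjects lam).fullImage, t ≫ (legObjects lam).incl = 𝟙 L := by
  have hp := (legObjects lam).incl_fullyFaithful
  -- The full image keeps the index as part of the object, so each leg factors strictly with a
  -- tautological choice on objects.
  let q (i : I) : F.obj i ⟶ (legObjects lam).fullImage :=
    (legObjects lam).lift (lam.leg i) (fun x => ⟨i, x⟩) (fun _ => rfl) (fun _ _ => rfl)
  have hq (i : I) : q i ≫ (legObjects lam).incl = lam.leg i := ObjectsOver.lift_incl _ _ _ _ _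
  obtain ⟨Q, e, he, hQ⟩ := lam.exists_lift q (fun i => eqToIso (hq i)) (fun i => .eqToHom (hq i))
    (hom_exists_lift_iso hp) (hom_whiskerRight_injective hp)
  obtain ⟨Ψ, -, h⟩ := hlam (legObjects lam).fullImage
  exact ⟨Ψ.obj Q, Pseudocone.comp_eq_id hlam (congrArg (fun Φ => Φ.obj Q) h) e he hQ⟩

/-- The section is `L ⟶ P ⟶ strictify L`, with `P` the full image of the legs. The lifts `m i` may
be chosen independently, because only their effect on objects is used on `P`. -/
theorem isFlexible_of_isPseudocolimit {lam : Pseudocone F L} (hlam : lam.IsPseudocolimit)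
    (hF : ∀ i, LiftsAlongCounit (F.obj i) L) : IsFlexible L := by
  obtain ⟨t, ht⟩ := exists_section_legObjects hlam
  choose m hm using fun i => hF i (liftNat (lam.leg i))
  -- On the summand with index `i` the lift on objects is `m i`; morphisms of `P` between different
  -- summands are handled by full faithfulness of the counit.
  let r : (legObjects lam).fullImage.comp liftCat.{v, u} ⟶ strictify (L.comp liftCat.{v, u}) :=
    (freeObjects _).lift (liftNat (legObjects lam).incl)
      (fun {X} x => ((m x.down.1).toPseudoNat.app X).toFunctor.obj (ULift.up x.down.2))
      (fun {X} x => congrArg (fun (θ : (F.obj x.down.1).comp liftCat.{v, u} ⟶ _) =>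
        (θ.toPseudoNat.app X).toFunctor.obj (ULift.up x.down.2)) (hm x.down.1))
      (fun {X Y} f x => TwoNat.app_map_obj (m x.down.1) f (ULift.up x.down.2))
  have hr : r ≫ counit _ = liftNat (legObjects lam).incl := ObjectsOver.lift_incl _ _ _ _ _
  refine isFlexible_of_section (liftNat t ≫ r) ?_
  rw [hom_assoc, hr, ← liftNat_comp, ht, liftNat_id]

end Main

end TwoCat


theorem mainTheorem10 (C : Type u) [Bicategory.{v, v} C] [Bicategory.Strict C] :
    -- small pseudocolimits of flexible 2-functors are flexible
    (∀ (I : Type v) [Bicategory.{v, v} I] [Bicategory.Strict I]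
      (F : TwoCat.TwoFunctor I (TwoCat.TwoFunctor C Cat.{v, v}))
      (L : TwoCat.TwoFunctor C Cat.{v, v}) (lam : TwoCat.Pseudocone F L),
      lam.IsPseudocolimit → (∀ i : I, TwoCat.IsFlexible (F.obj i)) → TwoCat.IsFlexible L) ∧
    -- small pseudocolimits of representable 2-functors are flexible
    (∀ (I : Type v) [Bicategory.{v, v} I] [Bicategory.Strict I]
      (F : TwoCat.TwoFunctor I (TwoCat.TwoFunctor C Cat.{v, v}))
      (L : TwoCat.TwoFunctor C Cat.{v, v}) (lam : TwoCat.Pseudocone F L),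
      lam.IsPseudocolimit → (∀ i : I, TwoCat.IsRepresentable (F.obj i)) →
        TwoCat.IsFlexible L) ∧
    -- the 2-functor associated with a 2-pro-object is flexible
    (∀ (X : TwoCat.TwoProObject C) (L : TwoCat.TwoFunctor C Cat.{v, v}),
      X.IsAssociated L → TwoCat.IsFlexible L) := by
  refine ⟨fun I _ _ F L lam hlam hF => ?_, fun I _ _ F L lam hlam hF => ?_, fun X L hL => ?_⟩
  · exact TwoCat.isFlexible_of_isPseudocolimit hlam fun i => (hF i).liftsAlongCounit L
  · exact TwoCat.isFlexible_of_isPseudocolimit hlam fun i => (hF i).liftsAlongCounit L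
  · obtain ⟨lam, hlam⟩ := hL
    -- The diagram of a 2-pro-object takes the values `rep (X_i)` by definition.
    exact TwoCat.isFlexible_of_isPseudocolimit hlam fun i =>
      TwoCat.liftsAlongCounit_rep (X.diagram.obj (op i)) L
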